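/- Let $R=\mathbb{C}[x_1,\dots,x_n]$ with $\deg x_i=1$, and let $D\subset\mathbb{C}^n$ be a central reduced hyperplane arrangement, with defining polynomial $f$ equal to a product of nonzero linear forms ($f$ squarefree), and put $\deg D:=\deg f$. Assume that $D$ is essential, i.e. the intersection of all the hyperplanes of $D$ is $\{0\}$ (equivalently, $D$ cannot be defined by a polynomial in fewer than $n$ variables after a linear change of coordinates). Let $$\mathrm{Der}_R(-\log D)=\{\theta\in\mathrm{Der}_{\mathbb{C}}(R)\mid \theta(f)\in (f)\}$$ be the graded $R$-module of logarithmic vector fields, graded so that $\deg \partial/\partial x_i=-1$. For a finitely generated graded $R$-module $M$ with minimal graded free resolution $\cdots\to F_1\to F_0\to M\to 0$, $F_j=\bigoplus_k R(-c_{j,k})$ of finite rank, let $\mathrm{reg}\,M:=\max_{j,k}(c_{j,k}-j)$ be its Castelnuovo–Mumford regularity (with $\mathrm{reg}\,0=-\infty$). Then $\mathrm{Der}_R(-\log D)$ has a minimal graded free resolution with terms of finite rank, and $$\mathrm{reg}\,\mathrm{Der}_R(-\log D)\le \deg D-n .$$ -/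

import Mathlib

open MvPolynomial

noncomputable section

/-! ### Graded modules over `R = ℂ[x₁, …, xₙ]` and Castelnuovo–Mumford regularity -/

/-- The homogeneous part `R_e` of degree `e ∈ ℤ` of `R = ℂ[x₁, …, xₙ]`, where `deg xᵢ = 1`
(so `R_e = 0` for `e < 0`). -/
def polyPiece (n : ℕ) (e : ℤ) : Submodule ℂ (MvPolynomial (Fin n) ℂ) :=
  weightedHomogeneousSubmodule ℂ (fun _ : Fin n => (1 : ℤ)) e

/-- The graded maximal ideal `𝔪 = (x₁, …, xₙ)` of `R`. -/
def gradedMaximalIdeal (n : ℕ) : Ideal (MvPolynomial (Fin n) ℂ) :=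
  Ideal.span (Set.range X)

/-- The homogeneous part of degree `m` of the graded free module `⨁ₖ R(-cₖ)`: its `k`-th
component is `R(-cₖ)_m = R_{m - cₖ}`. -/
def freePiece {n r : ℕ} (c : Fin r → ℤ) (m : ℤ) :
    Submodule ℂ (Fin r → MvPolynomial (Fin n) ℂ) :=
  Submodule.pi Set.univ fun k => polyPiece n (m - c k)

/-- A minimal graded free resolution `⋯ → F₁ → F₀ → M → 0` of an `R`-module `M` graded by the
family `𝓜`, with `F_j = ⨁ₖ R(-c_{j,k})` of finite rank and all maps homogeneous of degree `0`.
Minimality says that the image of `F_{j+1} → F_j` lies in `𝔪 F_j`. -/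
structure MinimalGradedFreeResolution {n : ℕ} {M : Type*} [AddCommGroup M] [Module ℂ M]
    [Module (MvPolynomial (Fin n) ℂ) M] [IsScalarTower ℂ (MvPolynomial (Fin n) ℂ) M]
    (𝓜 : ℤ → Submodule ℂ M) where
  /-- the rank of `F_j` -/
  rank : ℕ → ℕ
  /-- the integers `c_{j,k}` -/
  shift : ∀ j, Fin (rank j) → ℤ
  /-- the differential `F_{j+1} → F_j` -/
  diff : ∀ j, (Fin (rank (j + 1)) → MvPolynomial (Fin n) ℂ) →ₗ[MvPolynomial (Fin n) ℂ]
    (Fin (rank j) → MvPolynomial (Fin n) ℂ)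
  /-- the augmentation `F₀ → M` -/
  aug : (Fin (rank 0) → MvPolynomial (Fin n) ℂ) →ₗ[MvPolynomial (Fin n) ℂ] M
  diff_graded : ∀ j m, ∀ v ∈ freePiece (shift (j + 1)) m, diff j v ∈ freePiece (shift j) m
  aug_graded : ∀ m, ∀ v ∈ freePiece (shift 0) m, aug v ∈ 𝓜 m
  aug_surjective : Function.Surjective aug
  exact_aug : Function.Exact (diff 0) aug
  exact_diff : ∀ j, Function.Exact (diff (j + 1)) (diff j)
  minimal : ∀ j v k, diff j v k ∈ gradedMaximalIdeal n

/-- The Castelnuovo–Mumford regularity `reg M = max_{j,k} (c_{j,k} - j)`, where the `c_{j,k}` are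
the shifts in a minimal graded free resolution of `M`; by convention it is `-∞` for `M = 0`.
(Minimal graded free resolutions are unique up to isomorphism, so taking the supremum over all of
them does not change the value; it is only meaningful if one exists.) -/
def cmRegularity (n : ℕ) {M : Type*} [AddCommGroup M] [Module ℂ M]
    [Module (MvPolynomial (Fin n) ℂ) M] [IsScalarTower ℂ (MvPolynomial (Fin n) ℂ) M]
    (𝓜 : ℤ → Submodule ℂ M) : EReal :=
  ⨆ (F : MinimalGradedFreeResolution (n := n) 𝓜) (j : ℕ) (k : Fin (F.rank j)),
    (((F.shift j k - j : ℤ) : ℝ) : EReal)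

/-! ### Logarithmic vector fields -/

/-- `Der_R(-log D)` for the divisor `D` defined by `f`: the `R`-module of polynomial vector fields
`θ` on `ℂⁿ` with `θ(f) ∈ (f)`. -/
def logDer {n : ℕ} (f : MvPolynomial (Fin n) ℂ) :
    Submodule (MvPolynomial (Fin n) ℂ)
      (Derivation ℂ (MvPolynomial (Fin n) ℂ) (MvPolynomial (Fin n) ℂ)) where
  carrier := {θ | θ f ∈ Ideal.span {f}}
  add_mem' {a b} ha hb := by
    simpa using Ideal.add_mem _ ha hb
  zero_mem' := by simp
  smul_mem' c θ h := by
    simpa using Ideal.mul_mem_left _ c h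

/-- The vector fields `θ = ∑ᵢ θ(xᵢ) ∂/∂xᵢ` that are homogeneous of degree `m`, in the grading where
`deg xᵢ = 1` and `deg ∂/∂xᵢ = -1`: the coefficients `θ(xᵢ)` are homogeneous of degree `m + 1`. -/
def derPiece (n : ℕ) (m : ℤ) :
    Submodule ℂ (Derivation ℂ (MvPolynomial (Fin n) ℂ) (MvPolynomial (Fin n) ℂ)) where
  carrier := {θ | ∀ i, θ (X i) ∈ polyPiece n (m + 1)}
  add_mem' {a b} ha hb i := by
    simpa using Submodule.add_mem _ (ha i) (hb i)
  zero_mem' i := by simp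
  smul_mem' c θ h i := by
    simpa using Submodule.smul_mem _ c (h i)

/-- The grading of `Der_R(-log D)` induced by that of `Der_R`. -/
def logDerPiece {n : ℕ} (f : MvPolynomial (Fin n) ℂ) (m : ℤ) : Submodule ℂ (logDer f) :=
  (derPiece n m).comap ((logDer f).subtype.restrictScalars ℂ)

/-! ### Hyperplane arrangements -/

/-- A central hyperplane arrangement in `ℂⁿ`, given by finitely many nonzero linear forms
(a hyperplane may be repeated; see `IsReduced`). -/
structure CentralArrangement (n : ℕ) where
  /-- the number of linear forms -/
  size : ℕ
  /-- the linear forms whose zero sets are the hyperplanes -/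
  form : Fin size → MvPolynomial (Fin n) ℂ
  form_isHomogeneous : ∀ i, (form i).IsHomogeneous 1
  form_ne_zero : ∀ i, form i ≠ 0

namespace CentralArrangement

/-- The defining polynomial `f`, the product of the linear forms. -/
def definingPoly {n : ℕ} (D : CentralArrangement n) : MvPolynomial (Fin n) ℂ :=
  ∏ i, D.form i

/-- `deg D = deg f`. -/
def degree {n : ℕ} (D : CentralArrangement n) : ℕ := D.definingPoly.totalDegree

/-- The divisor `D` is reduced. -/
def IsReduced {n : ℕ} (D : CentralArrangement n) : Prop := Squarefree D.definingPoly

/-- `D` is essential: the intersection of all its hyperplanes is the origin. -/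
def IsEssential {n : ℕ} (D : CentralArrangement n) : Prop :=
  ∀ x : Fin n → ℂ, (∀ i, eval x (D.form i) = 0) → x = 0

end CentralArrangement

end

/-! Regularity is read off Koszul homology. With coefficients of degree `t`, the Koszul homology of
`M` is the sum over `i` of `Tor_i(M, ℂ)` in degree `t + i`, so `M` is `r`-regular as soon as all
cycles with coefficients of degree `t > r` bound (`KoszulRegular`). Exterior degrees need not be
tracked.

For any finite family of nonzero linear forms, with `d` members and rank `ρ`, the module `D(B)` of
fields logarithmic along each form is shown to be `(d - ρ)`-regular, by induction on the family
(`koszulRegular_logModule`); essentiality gives `ρ = n`. If some form `a_j` is independent of the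
others, `D(B)` is a direct summand of the module of the deletion plus a free summand `R a_j ∂_v`
generated in degree `0`. Otherwise every deletion keeps the rank, hence is `(d - ρ - 1)`-regular,
and `a_j D(B \ j) ⊆ D(B) ⊆ D(B \ j)`. This is the setting of regularity by approximation
(Derksen–Sidman): on the Koszul homology of `D(B)` in the relevant degrees, contraction with a
vector `v` such that `a_j(v) = 1` can be cancelled (`annList_boundary_of_cons`). Cancelling for a
basis of the span chosen among the forms, it remains to see that the product of these `ρ`
contractions kills homology. The remaining variables can be eliminated, because the arrangement is
constant in their dual directions (`exists_homologous_ann_eq_zero`), and the top contraction then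
vanishes because the module is torsion-free (`annList_eq_zero_of_cycle`).

To return to resolutions: regularity bounds the degrees of minimal generators
(`KoszulRegular.shift_le`) and rises by at most one on passing to syzygies (`KoszulRegular.ker`).
Hence it bounds the shifts of every minimal resolution; one exists by iterating minimal covers. -/

noncomputable section

/-! ### Homogeneous components and linear forms -/

section Polynomials

variable {n : ℕ}

/-- The homogeneous component of degree `e ∈ ℤ` of a polynomial. -/
def polyComp (n : ℕ) (e : ℤ) : MvPolynomial (Fin n) ℂ →ₗ[ℂ] MvPolynomial (Fin n) ℂ :=
  weightedHomogeneousComponent (fun _ : Fin n => (1 : ℤ)) e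

theorem polyComp_mem (e : ℤ) (p : MvPolynomial (Fin n) ℂ) : polyComp n e p ∈ polyPiece n e :=
  weightedHomogeneousComponent_mem _ _ _

theorem polyComp_of_mem {e e' : ℤ} {p : MvPolynomial (Fin n) ℂ} (h : p ∈ polyPiece n e) :
    polyComp n e' p = if e' = e then p else 0 :=
  weightedHomogeneousComponent_of_mem h

theorem mul_mem_polyPiece {a b : ℤ} {p q : MvPolynomial (Fin n) ℂ} (hp : p ∈ polyPiece n a)
    (hq : q ∈ polyPiece n b) : p * q ∈ polyPiece n (a + b) :=
  IsWeightedHomogeneous.mul hp hq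

theorem C_mem_polyPiece (a : ℂ) : (C a : MvPolynomial (Fin n) ℂ) ∈ polyPiece n 0 :=
  isWeightedHomogeneous_C _ _

theorem X_mem_polyPiece (i : Fin n) : (X i : MvPolynomial (Fin n) ℂ) ∈ polyPiece n 1 :=
  isWeightedHomogeneous_X _ _ _

theorem monomial_mem_polyPiece (d : Fin n →₀ ℕ) (a : ℂ) :
    monomial d a ∈ polyPiece n (Finsupp.weight (fun _ : Fin n => (1 : ℤ)) d) :=
  isWeightedHomogeneous_monomial _ _ _ rfl

theorem C_mul_mem_polyPiece {e : ℤ} {p : MvPolynomial (Fin n) ℂ} (a : ℂ) (hp : p ∈ polyPiece n e) :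
    C a * p ∈ polyPiece n e := by
  simpa using mul_mem_polyPiece (C_mem_polyPiece a) hp

theorem polyComp_mul {a : ℤ} {q : MvPolynomial (Fin n) ℂ} (hq : q ∈ polyPiece n a) (e : ℤ)
    (p : MvPolynomial (Fin n) ℂ) : polyComp n (a + e) (q * p) = q * polyComp n e p := by
  induction p using MvPolynomial.induction_on' with
  | monomial d r =>
    rw [polyComp_of_mem (mul_mem_polyPiece hq (monomial_mem_polyPiece d r)),
      polyComp_of_mem (monomial_mem_polyPiece d r)]
    simp
  | add p p' hp hp' => rw [mul_add, map_add, map_add, hp, hp', mul_add]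

/-- Keeps quotients by linear forms homogeneous, so that witnesses of divisibility are again Koszul
chains of the right degree. -/
theorem mem_polyPiece_of_mul_mem {a e : ℤ} {p q : MvPolynomial (Fin n) ℂ}
    (hq : q ∈ polyPiece n a) (hq0 : q ≠ 0) (h : q * p ∈ polyPiece n (a + e)) :
    p ∈ polyPiece n e := by
  have h1 := polyComp_mul hq e p
  rw [polyComp_of_mem h, if_pos rfl] at h1
  rw [mul_left_cancel₀ hq0 h1]
  exact polyComp_mem _ _

/-- Allowing every larger `t` lets the finitely many entries of a vector share one index set. -/
theorem exists_sum_polyComp (p : MvPolynomial (Fin n) ℂ) :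
    ∃ s : Finset ℤ, ∀ t : Finset ℤ, s ⊆ t → p = ∑ e ∈ t, polyComp n e p := by
  induction p using MvPolynomial.induction_on' with
  | monomial d r =>
    refine ⟨{Finsupp.weight (fun _ : Fin n => (1 : ℤ)) d}, fun t ht => ?_⟩
    simp_rw [polyComp_of_mem (monomial_mem_polyPiece d r)]
    rw [Finset.sum_ite_eq' t, if_pos (ht (Finset.mem_singleton_self _))]
  | add p q hp hq =>
    obtain ⟨s, hs⟩ := hp
    obtain ⟨s', hs'⟩ := hq
    refine ⟨s ∪ s', fun t ht => ?_⟩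
    simp_rw [map_add, Finset.sum_add_distrib]
    rw [← hs t (Finset.union_subset_left ht), ← hs' t (Finset.union_subset_right ht)]

theorem coeff_zero_eq_zero_of_mem_polyPiece {e : ℤ} {p : MvPolynomial (Fin n) ℂ}
    (hp : p ∈ polyPiece n e) (he : e ≠ 0) : constantCoeff p = 0 := by
  have h := IsWeightedHomogeneous.coeff_eq_zero hp (0 : Fin n →₀ ℕ) (by simpa using he.symm)
  simpa [constantCoeff_eq] using h

/-- A polynomial of degree `0` is constant. -/
theorem eq_C_of_mem_polyPiece_zero {p : MvPolynomial (Fin n) ℂ} (hp : p ∈ polyPiece n 0) :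
    p = C (constantCoeff p) := by
  ext d
  rw [coeff_C]
  split_ifs with h
  · rw [← h, constantCoeff_eq]
  · refine IsWeightedHomogeneous.coeff_eq_zero hp d fun h0 => h ?_
    have h1 : ∑ i, (d i : ℤ) = 0 := by
      rw [← h0, Finsupp.weight_apply, Finsupp.sum_fintype] <;> simp
    ext i
    have h2 := (Finset.sum_eq_zero_iff_of_nonneg (fun i _ => by positivity)).1 h1 i
      (Finset.mem_univ _)
    exact_mod_cast h2.symm

/-- The linear form with coefficient vector `a`. -/
def lin (a : Fin n → ℂ) : MvPolynomial (Fin n) ℂ := ∑ i, C (a i) * X i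

theorem lin_mem_polyPiece (a : Fin n → ℂ) : lin a ∈ polyPiece n 1 :=
  Submodule.sum_mem _ fun i _ => C_mul_mem_polyPiece _ (X_mem_polyPiece i)

theorem eval_lin (a x : Fin n → ℂ) : eval x (lin a) = a ⬝ᵥ x := by
  simp [lin, dotProduct]

theorem lin_single (i : Fin n) : lin (Pi.single i (1 : ℂ)) = X i := by
  simp [lin, Pi.single_apply]

theorem lin_ne_zero_of_dotProduct {a w : Fin n → ℂ} (h : a ⬝ᵥ w = 1) : lin a ≠ 0 := by
  intro h0
  have h1 := eval_lin a w
  rw [h0, h] at h1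
  simp at h1

theorem lin_mul_mem_polyPiece {e : ℤ} (a : Fin n → ℂ) {p : MvPolynomial (Fin n) ℂ}
    (hp : p ∈ polyPiece n (e - 1)) : lin a * p ∈ polyPiece n e := by
  simpa using mul_mem_polyPiece (lin_mem_polyPiece a) hp

/-- The substitution `x ↦ x - a(x) w`, which for `a(w) = 1` is the projection along `w` onto the
hyperplane `a = 0`. -/
def hypProj (a w : Fin n → ℂ) : MvPolynomial (Fin n) ℂ →ₐ[ℂ] MvPolynomial (Fin n) ℂ :=
  aeval fun i => X i - C (w i) * lin a

theorem hypProj_X (a w : Fin n → ℂ) (i : Fin n) : hypProj a w (X i) = X i - C (w i) * lin a :=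
  aeval_X _ _

theorem hypProj_C (a w : Fin n → ℂ) (r : ℂ) : hypProj a w (C r) = C r := by
  rw [hypProj, aeval_C]; rfl

theorem hypProj_lin (a w b : Fin n → ℂ) :
    hypProj a w (lin b) = lin b - C (b ⬝ᵥ w) * lin a := by
  conv_lhs => rw [lin]
  simp only [map_sum, map_mul, hypProj_C, hypProj_X, mul_sub, Finset.sum_sub_distrib, dotProduct]
  rw [← lin, Finset.sum_mul]
  simp only [mul_assoc]

theorem hypProj_lin_of_dotProduct_zero {a w b : Fin n → ℂ} (h : b ⬝ᵥ w = 0) :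
    hypProj a w (lin b) = lin b := by
  simp [hypProj_lin, h]

theorem hypProj_lin_self {a w : Fin n → ℂ} (h : a ⬝ᵥ w = 1) : hypProj a w (lin a) = 0 := by
  simp [hypProj_lin, h]

theorem hypProj_hypProj {a w : Fin n → ℂ} (h : a ⬝ᵥ w = 1) (p : MvPolynomial (Fin n) ℂ) :
    hypProj a w (hypProj a w p) = hypProj a w p := by
  have : (hypProj a w).comp (hypProj a w) = hypProj a w := by
    ext i
    simp [hypProj_X, hypProj_lin_self h]
  exact DFunLike.congr_fun this p

/-- The substitution moves each variable by a multiple of `lin a`, so it is the identity modulo `lin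
a`. -/
theorem lin_dvd_sub_hypProj (a w : Fin n → ℂ) (p : MvPolynomial (Fin n) ℂ) :
    lin a ∣ p - hypProj a w p := by
  induction p using MvPolynomial.induction_on with
  | C r => simp
  | add p q hp hq =>
    rw [map_add, add_sub_add_comm]
    exact dvd_add hp hq
  | mul_X p i hp =>
    have : p * X i - hypProj a w (p * X i) =
        (p - hypProj a w p) * X i + lin a * (hypProj a w p * C (w i)) := by
      rw [map_mul, hypProj_X]; ring
    rw [this]
    exact dvd_add (dvd_mul_of_dvd_left hp _) (dvd_mul_right _ _)

theorem hypProj_mem_polyPiece (a w : Fin n → ℂ) {e : ℤ} {p : MvPolynomial (Fin n) ℂ}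
    (hp : p ∈ polyPiece n e) : hypProj a w p ∈ polyPiece n e := by
  rw [hypProj, aeval_def, eval₂_eq']
  refine Submodule.sum_mem _ fun d hd => ?_
  refine C_mul_mem_polyPiece _ ?_
  have h1 : ∀ i, (X i - C (w i) * lin a) ∈ polyPiece n 1 := fun i =>
    Submodule.sub_mem _ (X_mem_polyPiece i) (C_mul_mem_polyPiece _ (lin_mem_polyPiece a))
  have h2 := IsWeightedHomogeneous.prod Finset.univ
    (fun i => (X i - C (w i) * lin a) ^ d i) (fun i => d i • (1 : ℤ))
    (w := fun _ : Fin n => (1 : ℤ)) fun i _ => IsWeightedHomogeneous.pow (h1 i) (d i)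
  have h3 : ∑ i, d i • (1 : ℤ) = e := by
    rw [← hp (mem_support_iff.1 hd), Finsupp.weight_apply, Finsupp.sum_fintype]; simp
  rw [h3] at h2
  exact h2

end Polynomials

/-! ### Graded submodules of graded free modules -/

section Graded

variable {n s : ℕ}

theorem mem_freePiece {c : Fin s → ℤ} {m : ℤ} {v : Fin s → MvPolynomial (Fin n) ℂ} :
    v ∈ freePiece c m ↔ ∀ k, v k ∈ polyPiece n (m - c k) := by
  simp [freePiece, Submodule.mem_pi]

theorem C_smul_mem_freePiece {c : Fin s → ℤ} {m : ℤ} {v : Fin s → MvPolynomial (Fin n) ℂ} (a : ℂ)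
    (hv : v ∈ freePiece c m) : (C a : MvPolynomial (Fin n) ℂ) • v ∈ freePiece c m :=
  mem_freePiece.2 fun k => C_mul_mem_polyPiece _ (mem_freePiece.1 hv k)

theorem smul_mem_freePiece {c : Fin s → ℤ} {a m : ℤ} {p : MvPolynomial (Fin n) ℂ}
    {v : Fin s → MvPolynomial (Fin n) ℂ} (hp : p ∈ polyPiece n a) (hv : v ∈ freePiece c m) :
    p • v ∈ freePiece c (m + a) :=
  mem_freePiece.2 fun k => by
    have := mul_mem_polyPiece hp (mem_freePiece.1 hv k)
    rwa [show a + (m - c k) = m + a - c k by ring] at this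

theorem mem_freePiece_of_smul_mem {c : Fin s → ℤ} {a m : ℤ} {p : MvPolynomial (Fin n) ℂ}
    {v : Fin s → MvPolynomial (Fin n) ℂ} (hp : p ∈ polyPiece n a) (hp0 : p ≠ 0)
    (hv : p • v ∈ freePiece c (m + a)) : v ∈ freePiece c m :=
  mem_freePiece.2 fun k => by
    have := mem_freePiece.1 hv k
    rw [show m + a - c k = a + (m - c k) by ring] at this
    exact mem_polyPiece_of_mul_mem hp hp0 this

/-- The homogeneous component of degree `m` of an element of a graded free module. -/
def freeComp (c : Fin s → ℤ) (m : ℤ) :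
    (Fin s → MvPolynomial (Fin n) ℂ) →ₗ[ℂ] (Fin s → MvPolynomial (Fin n) ℂ) :=
  LinearMap.pi fun k => (polyComp n (m - c k)).comp (LinearMap.proj k)

theorem freeComp_apply (c : Fin s → ℤ) (m : ℤ) (v : Fin s → MvPolynomial (Fin n) ℂ) (k : Fin s) :
    freeComp c m v k = polyComp n (m - c k) (v k) := rfl

theorem freeComp_mem (c : Fin s → ℤ) (m : ℤ) (v : Fin s → MvPolynomial (Fin n) ℂ) :
    freeComp c m v ∈ freePiece c m :=
  mem_freePiece.2 fun _ => polyComp_mem _ _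

theorem freeComp_of_mem {c : Fin s → ℤ} {m m' : ℤ} {v : Fin s → MvPolynomial (Fin n) ℂ}
    (hv : v ∈ freePiece c m) : freeComp c m' v = if m' = m then v else 0 := by
  ext1 k
  rw [freeComp_apply, polyComp_of_mem (mem_freePiece.1 hv k)]
  by_cases h : m' = m <;> simp [h]

theorem exists_sum_freeComp (c : Fin s → ℤ) (v : Fin s → MvPolynomial (Fin n) ℂ) :
    ∃ t : Finset ℤ, v = ∑ m ∈ t, freeComp c m v := by
  choose S hS using fun k => exists_sum_polyComp (v k)
  -- The part of degree `e` of entry `k` contributes to degree `e + c k` of the vector.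
  refine ⟨Finset.univ.biUnion fun k => (S k).image (· + c k), ?_⟩
  ext1 k
  rw [Finset.sum_apply]
  simp_rw [freeComp_apply]
  set T := Finset.univ.biUnion fun k => (S k).image (· + c k) with hT
  have h1 := hS k (T.image (· - c k)) fun e he => by
    refine Finset.mem_image.2 ⟨e + c k, Finset.mem_biUnion.2 ⟨k, Finset.mem_univ _, ?_⟩, by ring⟩
    exact Finset.mem_image.2 ⟨e, he, rfl⟩
  rw [Finset.sum_image (fun x _ y _ h => by simpa using h)] at h1
  exact h1

/-- A homogeneous linear map commutes with taking homogeneous components. -/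
theorem freeComp_map {s' : ℕ} {c : Fin s → ℤ} {c' : Fin s' → ℤ}
    (f : (Fin s → MvPolynomial (Fin n) ℂ) →ₗ[MvPolynomial (Fin n) ℂ]
      (Fin s' → MvPolynomial (Fin n) ℂ))
    (hf : ∀ m, ∀ v ∈ freePiece c m, f v ∈ freePiece c' m) (m : ℤ)
    (v : Fin s → MvPolynomial (Fin n) ℂ) : freeComp c' m (f v) = f (freeComp c m v) := by
  obtain ⟨t, ht⟩ := exists_sum_freeComp c v
  have h1 : ∀ m', freeComp c' m (f (freeComp c m' v)) = f (freeComp c m (freeComp c m' v)) := by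
    intro m'
    rw [freeComp_of_mem (hf m' _ (freeComp_mem c m' v)), freeComp_of_mem (freeComp_mem c m' v)]
    split_ifs <;> simp
  rw [ht]
  simp_rw [map_sum, h1]

/-- The submodule `Z` of `⨁ₖ R(-cₖ)` is graded. -/
def IsGradedSubmodule (c : Fin s → ℤ)
    (Z : Submodule (MvPolynomial (Fin n) ℂ) (Fin s → MvPolynomial (Fin n) ℂ)) : Prop :=
  ∀ v ∈ Z, ∀ m, freeComp c m v ∈ Z

end Graded

/-! ### The Koszul complex through creation and annihilation operators -/

/-- A matrix model of the exterior algebra on `n` generators: creation operators (exterior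
multiplication) and annihilation operators (contraction) acting on a space with a finite basis,
and a basis vector, the vacuum, killed by all annihilation operators. -/
structure ExteriorModel (n : ℕ) where
  /-- the index set of the basis -/
  idx : Type
  [fintype : Fintype idx]
  [decEq : DecidableEq idx]
  /-- contraction with the `i`-th dual basis vector -/
  annih : Fin n → Matrix idx idx ℂ
  /-- exterior multiplication by the `i`-th basis vector -/
  creat : Fin n → Matrix idx idx ℂ
  annih_annih : ∀ i j, annih i * annih j + annih j * annih i = 0
  creat_annih : ∀ i j, creat i * annih j + annih j * creat i = if i = j then 1 else 0
  /-- the vacuum -/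
  vac : idx
  annih_vac : ∀ i S, annih i S vac = 0

attribute [instance] ExteriorModel.fintype ExteriorModel.decEq

/-- Dividing by 2 turns anticommutation of an operator with itself into square zero. -/
theorem eq_zero_of_eq_neg_self (n : ℕ) {F : Type*} [AddCommGroup F]
    [Module (MvPolynomial (Fin n) ℂ) F] {z : F} (h : z = -z) : z = 0 := by
  have h2 : (C (2 : ℂ) : MvPolynomial (Fin n) ℂ) • z = 0 := by
    rw [show (C (2 : ℂ) : MvPolynomial (Fin n) ℂ) = 1 + 1 by rw [← C_1, ← C_add]; norm_num,
      add_smul, one_smul]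
    nth_rewrite 1 [h]
    simp
  calc z = (C (1 / 2 : ℂ) : MvPolynomial (Fin n) ℂ) • (C (2 : ℂ) : MvPolynomial (Fin n) ℂ) • z := by
        rw [smul_smul, ← C_mul]; norm_num
    _ = 0 := by rw [h2, smul_zero]

namespace ExteriorModel

/-- Adjoining one generator to a matrix model of the exterior algebra. -/
def extend {n : ℕ} (Λ : ExteriorModel n) : ExteriorModel (n + 1) where
  -- The right copy holds the products containing the new generator; the sign there makes the old
  -- operators anticommute with the new ones.
  idx := Λ.idx ⊕ Λ.idx
  annih := Fin.cons (Matrix.fromBlocks 0 1 0 0)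
    fun i => Matrix.fromBlocks (Λ.annih i) 0 0 (-Λ.annih i)
  creat := Fin.cons (Matrix.fromBlocks 0 0 1 0)
    fun i => Matrix.fromBlocks (Λ.creat i) 0 0 (-Λ.creat i)
  annih_annih i j := by
    refine Fin.cases ?_ (fun i => ?_) i <;> refine Fin.cases ?_ (fun j => ?_) j <;>
      simp [Matrix.fromBlocks_multiply, Matrix.fromBlocks_add, Λ.annih_annih]
  creat_annih i j := by
    refine Fin.cases ?_ (fun i => ?_) i <;> refine Fin.cases ?_ (fun j => ?_) j
    · simp [Matrix.fromBlocks_multiply, Matrix.fromBlocks_add]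
    · simp [Matrix.fromBlocks_multiply, Matrix.fromBlocks_add, (Fin.succ_ne_zero _).symm]
    · simp [Matrix.fromBlocks_multiply, Matrix.fromBlocks_add]
    · simp only [Fin.cons_succ, Matrix.fromBlocks_multiply, Matrix.fromBlocks_add, Fin.succ_inj]
      simp only [mul_zero, zero_mul, add_zero, zero_add, neg_mul_neg, Λ.creat_annih]
      split_ifs <;> simp
  vac := Sum.inl Λ.vac
  annih_vac i S := by
    refine Fin.cases ?_ (fun i => ?_) i <;> rcases S with S | S <;> simp [Λ.annih_vac]

/-- A matrix model of the exterior algebra exists. -/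
def build : ∀ n : ℕ, ExteriorModel n
  | 0 => ⟨Unit, fun _ => 0, fun _ => 0, fun i => i.elim0, fun i => i.elim0, (), fun i => i.elim0⟩
  | n + 1 => (build n).extend

variable {n : ℕ} (Λ : ExteriorModel n)

section Operators

variable {F : Type*} [AddCommGroup F] [Module (MvPolynomial (Fin n) ℂ) F]

/-- The action of a complex matrix on the base change of the exterior algebra to `F`. -/
def matAct : Matrix Λ.idx Λ.idx ℂ →+* Module.End (MvPolynomial (Fin n) ℂ) (Λ.idx → F) where
  toFun A := LinearMap.pi fun S => ∑ T, (C (A S T) : MvPolynomial (Fin n) ℂ) • LinearMap.proj T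
  map_one' := by
    ext z S
    simp [Matrix.one_apply, ite_smul, apply_ite (C : ℂ → MvPolynomial (Fin n) ℂ)]
  map_zero' := by
    ext z S
    simp
  map_add' A B := by
    ext z S
    simp [add_smul, Finset.sum_add_distrib]
  map_mul' A B := by
    refine LinearMap.ext fun z => funext fun S => ?_
    simp only [LinearMap.pi_apply, LinearMap.coe_sum, Finset.sum_apply, LinearMap.smul_apply,
      LinearMap.proj_apply, Module.End.mul_apply, Matrix.mul_apply, map_sum, map_mul,
      Finset.sum_smul, Finset.smul_sum, mul_smul]
    rw [Finset.sum_comm]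

theorem matAct_apply (A : Matrix Λ.idx Λ.idx ℂ) (z : Λ.idx → F) (S : Λ.idx) :
    Λ.matAct A z S = ∑ T, (C (A S T) : MvPolynomial (Fin n) ℂ) • z T := by
  simp [matAct]

/-- Contraction with the vector `v`. -/
def ann (v : Fin n → ℂ) : Module.End (MvPolynomial (Fin n) ℂ) (Λ.idx → F) :=
  Λ.matAct (∑ i, v i • Λ.annih i)

/-- Exterior multiplication by the linear form with coefficient vector `a`. -/
def cre (a : Fin n → ℂ) : Module.End (MvPolynomial (Fin n) ℂ) (Λ.idx → F) :=
  Λ.matAct (∑ i, a i • Λ.creat i)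

/-- The Koszul differential. -/
def kos : Module.End (MvPolynomial (Fin n) ℂ) (Λ.idx → F) :=
  ∑ i, (X i : MvPolynomial (Fin n) ℂ) • Λ.matAct (Λ.annih i)

theorem matAct_smul (r : ℂ) (A : Matrix Λ.idx Λ.idx ℂ) :
    (Λ.matAct (r • A) : Module.End (MvPolynomial (Fin n) ℂ) (Λ.idx → F)) =
      (C r : MvPolynomial (Fin n) ℂ) • Λ.matAct A := by
  refine LinearMap.ext fun z => funext fun S => ?_
  simp only [LinearMap.smul_apply, Pi.smul_apply, matAct_apply, Matrix.smul_apply, smul_eq_mul,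
    map_mul, mul_smul, Finset.smul_sum]

theorem ann_eq (v : Fin n → ℂ) : (Λ.ann v : Module.End (MvPolynomial (Fin n) ℂ) (Λ.idx → F)) =
    ∑ i, (C (v i) : MvPolynomial (Fin n) ℂ) • Λ.matAct (Λ.annih i) := by
  simp [ann, matAct_smul]

theorem annih_mul_ann (i : Fin n) (w : Fin n → ℂ) :
    (Λ.matAct (Λ.annih i) * Λ.ann w : Module.End (MvPolynomial (Fin n) ℂ) (Λ.idx → F)) =
      -(Λ.ann w * Λ.matAct (Λ.annih i)) := by
  rw [ann, ← map_mul, ← map_mul, eq_neg_iff_add_eq_zero, ← map_add, ← map_zero Λ.matAct]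
  congr 1
  simp only [Finset.mul_sum, Finset.sum_mul, ← Finset.sum_add_distrib, mul_smul_comm,
    smul_mul_assoc, ← smul_add, Λ.annih_annih, smul_zero, Finset.sum_const_zero]

theorem ann_mul_ann (v w : Fin n → ℂ) :
    (Λ.ann v * Λ.ann w : Module.End (MvPolynomial (Fin n) ℂ) (Λ.idx → F)) =
      -(Λ.ann w * Λ.ann v) := by
  simp only [Λ.ann_eq v, Finset.sum_mul, Finset.mul_sum, smul_mul_assoc, mul_smul_comm,
    annih_mul_ann, smul_neg, Finset.sum_neg_distrib]

theorem ann_ann (v w : Fin n → ℂ) (z : Λ.idx → F) : Λ.ann v (Λ.ann w z) = -Λ.ann w (Λ.ann v z) :=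
  LinearMap.congr_fun (Λ.ann_mul_ann v w) z

theorem kos_mul_ann (v : Fin n → ℂ) :
    (Λ.kos * Λ.ann v : Module.End (MvPolynomial (Fin n) ℂ) (Λ.idx → F)) =
      -(Λ.ann v * Λ.kos) := by
  simp only [kos, Finset.sum_mul, Finset.mul_sum, smul_mul_assoc, mul_smul_comm,
    annih_mul_ann, smul_neg, Finset.sum_neg_distrib]

theorem kos_ann (v : Fin n → ℂ) (z : Λ.idx → F) : Λ.kos (Λ.ann v z) = -Λ.ann v (Λ.kos z) :=
  LinearMap.congr_fun (Λ.kos_mul_ann v) z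

theorem ann_ann_self (v : Fin n → ℂ) (z : Λ.idx → F) : Λ.ann v (Λ.ann v z) = 0 :=
  eq_zero_of_eq_neg_self n (Λ.ann_ann v v z)

theorem annih_mul_cre (i : Fin n) (a : Fin n → ℂ) :
    (Λ.matAct (Λ.annih i) * Λ.cre a + Λ.cre a * Λ.matAct (Λ.annih i) :
      Module.End (MvPolynomial (Fin n) ℂ) (Λ.idx → F)) = (C (a i) : MvPolynomial (Fin n) ℂ) • 1 := by
  rw [cre, ← map_mul, ← map_mul, ← map_add]
  have : Λ.annih i * (∑ j, a j • Λ.creat j) + (∑ j, a j • Λ.creat j) * Λ.annih i = a i • 1 := by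
    simp only [Finset.mul_sum, Finset.sum_mul, ← Finset.sum_add_distrib, mul_smul_comm,
      smul_mul_assoc, ← smul_add]
    simp_rw [add_comm (Λ.annih i * _), Λ.creat_annih]
    simp
  rw [this, matAct_smul, map_one]

theorem ann_cre (a v : Fin n → ℂ) (z : Λ.idx → F) :
    Λ.ann v (Λ.cre a z) = (C (a ⬝ᵥ v) : MvPolynomial (Fin n) ℂ) • z - Λ.cre a (Λ.ann v z) := by
  rw [eq_sub_iff_add_eq]
  have : (Λ.ann v * Λ.cre a + Λ.cre a * Λ.ann v :
      Module.End (MvPolynomial (Fin n) ℂ) (Λ.idx → F)) =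
        (C (a ⬝ᵥ v) : MvPolynomial (Fin n) ℂ) • 1 := by
    simp only [ann_eq, Finset.mul_sum, Finset.sum_mul, ← Finset.sum_add_distrib, mul_smul_comm,
      smul_mul_assoc, ← smul_add, annih_mul_cre, dotProduct, map_sum, Finset.sum_smul, smul_smul]
    refine Finset.sum_congr rfl fun i _ => ?_
    rw [← C_mul, mul_comm]
  exact LinearMap.congr_fun this z

theorem ann_cre_of_one {a v : Fin n → ℂ} (h : a ⬝ᵥ v = 1) (z : Λ.idx → F) :
    Λ.ann v (Λ.cre a z) = z - Λ.cre a (Λ.ann v z) := by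
  rw [ann_cre, h, C_1, one_smul]

theorem ann_cre_of_zero {a v : Fin n → ℂ} (h : a ⬝ᵥ v = 0) (z : Λ.idx → F) :
    Λ.ann v (Λ.cre a z) = -Λ.cre a (Λ.ann v z) := by
  rw [ann_cre, h, C_0, zero_smul, zero_sub]

/-- Exterior multiplication by `a` is a homotopy from multiplication by `lin a` to zero. -/
theorem kos_cre (a : Fin n → ℂ) (z : Λ.idx → F) :
    Λ.kos (Λ.cre a z) = lin a • z - Λ.cre a (Λ.kos z) := by
  rw [eq_sub_iff_add_eq]
  have : (Λ.kos * Λ.cre a + Λ.cre a * Λ.kos :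
      Module.End (MvPolynomial (Fin n) ℂ) (Λ.idx → F)) = lin a • 1 := by
    simp only [kos, Finset.mul_sum, Finset.sum_mul, ← Finset.sum_add_distrib, mul_smul_comm,
      smul_mul_assoc, ← smul_add, annih_mul_cre, lin, Finset.sum_smul, smul_smul]
    refine Finset.sum_congr rfl fun i _ => ?_
    rw [mul_comm]
  exact LinearMap.congr_fun this z

theorem kos_kos (z : Λ.idx → F) : Λ.kos (Λ.kos z) = 0 := by
  refine eq_zero_of_eq_neg_self n ?_
  have h1 : ∀ i, (Λ.matAct (Λ.annih i) : Module.End (MvPolynomial (Fin n) ℂ) (Λ.idx → F)) =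
      Λ.ann (Pi.single i 1) := fun i => by
    rw [ann_eq, Finset.sum_eq_single i] <;> simp +contextual
  have h2 : (Λ.kos * Λ.kos : Module.End (MvPolynomial (Fin n) ℂ) (Λ.idx → F)) =
      -(Λ.kos * Λ.kos) := by
    calc (Λ.kos * Λ.kos : Module.End (MvPolynomial (Fin n) ℂ) (Λ.idx → F))
        = ∑ i, (X i : MvPolynomial (Fin n) ℂ) • (Λ.kos * Λ.ann (Pi.single i 1)) := by
          conv_lhs => rw [kos, Finset.mul_sum]
          conv_rhs => simp only [← h1]
          simp only [mul_smul_comm]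
          rfl
      _ = -(Λ.kos * Λ.kos) := by
          simp only [kos_mul_ann, smul_neg, Finset.sum_neg_distrib]
          simp only [← h1, ← smul_mul_assoc]
          rw [← Finset.sum_mul]
          rfl
  exact LinearMap.congr_fun h2 z

/-- The Koszul differential in terms of a pair of dual bases. -/
theorem kos_eq_sum_lin {κ : Type*} [Fintype κ] {b v : κ → Fin n → ℂ}
    (h : ∀ i j, ∑ k, b k i * v k j = if i = j then 1 else 0) (z : Λ.idx → F) :
    Λ.kos z = ∑ k, lin (b k) • Λ.ann (v k) z := by
  have h1 : ∀ j, (X j : MvPolynomial (Fin n) ℂ) = ∑ k, C (v k j) * lin (b k) := fun j => by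
    simp only [lin, Finset.mul_sum, ← mul_assoc, ← C_mul]
    rw [Finset.sum_comm]
    simp only [← Finset.sum_mul, ← map_sum, mul_comm (v _ j), h]
    simp [ite_mul]
  simp only [kos, ann_eq, LinearMap.sum_apply, LinearMap.smul_apply, Finset.smul_sum, smul_smul]
  rw [Finset.sum_comm]
  refine Finset.sum_congr rfl fun j _ => ?_
  rw [← Finset.sum_smul, h1 j]
  simp only [mul_comm]

variable {F' : Type*} [AddCommGroup F'] [Module (MvPolynomial (Fin n) ℂ) F']

theorem matAct_map (f : F →ₗ[MvPolynomial (Fin n) ℂ] F') (A : Matrix Λ.idx Λ.idx ℂ)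
    (z : Λ.idx → F) : Λ.matAct A (fun S => f (z S)) = fun S => f (Λ.matAct A z S) := by
  ext1 S
  simp [matAct_apply]

theorem kos_apply (z : Λ.idx → F) (S : Λ.idx) :
    Λ.kos z S = ∑ i, (X i : MvPolynomial (Fin n) ℂ) • Λ.matAct (Λ.annih i) z S := by
  simp [kos]

theorem ann_apply (v : Fin n → ℂ) (z : Λ.idx → F) (S : Λ.idx) :
    Λ.ann v z S = ∑ i, (C (v i) : MvPolynomial (Fin n) ℂ) • Λ.matAct (Λ.annih i) z S := by
  simp [ann_eq]

theorem kos_map (f : F →ₗ[MvPolynomial (Fin n) ℂ] F') (z : Λ.idx → F) :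
    Λ.kos (fun S => f (z S)) = fun S => f (Λ.kos z S) := by
  ext1 S
  simp [kos_apply, matAct_map]

end Operators

end ExteriorModel

/-! ### Koszul chains of graded submodules and regularity -/

namespace ExteriorModel

variable {n : ℕ} (Λ : ExteriorModel n) {s : ℕ}

/-- The Koszul chains of a graded submodule `Z` of `⨁ₖ R(-cₖ)` with coefficients of degree `t`. -/
def strand (c : Fin s → ℤ)
    (Z : Submodule (MvPolynomial (Fin n) ℂ) (Fin s → MvPolynomial (Fin n) ℂ)) (t : ℤ) :
    AddSubgroup (Λ.idx → Fin s → MvPolynomial (Fin n) ℂ) where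
  carrier := {z | ∀ S, z S ∈ Z ∧ z S ∈ freePiece c t}
  add_mem' hz hw S := ⟨add_mem (hz S).1 (hw S).1, add_mem (hz S).2 (hw S).2⟩
  zero_mem' _ := ⟨zero_mem _, zero_mem _⟩
  neg_mem' hz S := ⟨neg_mem (hz S).1, neg_mem (hz S).2⟩

variable {c : Fin s → ℤ}
  {Z Z' : Submodule (MvPolynomial (Fin n) ℂ) (Fin s → MvPolynomial (Fin n) ℂ)} {t : ℤ}

theorem strand_mono (h : Z ≤ Z') : Λ.strand c Z t ≤ Λ.strand c Z' t :=
  fun _ hz S => ⟨h (hz S).1, (hz S).2⟩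

theorem matAct_mem_strand (A : Matrix Λ.idx Λ.idx ℂ) {z : Λ.idx → Fin s → MvPolynomial (Fin n) ℂ}
    (hz : z ∈ Λ.strand c Z t) : Λ.matAct A z ∈ Λ.strand c Z t := fun S => by
  rw [matAct_apply]
  exact ⟨Submodule.sum_mem _ fun T _ => Z.smul_mem _ (hz T).1,
    Submodule.sum_mem _ fun T _ => C_smul_mem_freePiece _ (hz T).2⟩

theorem ann_mem_strand (v : Fin n → ℂ) {z : Λ.idx → Fin s → MvPolynomial (Fin n) ℂ}
    (hz : z ∈ Λ.strand c Z t) : Λ.ann v z ∈ Λ.strand c Z t := Λ.matAct_mem_strand _ hz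

theorem cre_mem_strand (a : Fin n → ℂ) {z : Λ.idx → Fin s → MvPolynomial (Fin n) ℂ}
    (hz : z ∈ Λ.strand c Z t) : Λ.cre a z ∈ Λ.strand c Z t := Λ.matAct_mem_strand _ hz

theorem kos_mem_strand {z : Λ.idx → Fin s → MvPolynomial (Fin n) ℂ}
    (hz : z ∈ Λ.strand c Z (t - 1)) : Λ.kos z ∈ Λ.strand c Z t := fun S => by
  rw [kos_apply]
  refine ⟨Submodule.sum_mem _ fun i _ => Z.smul_mem _ (Λ.matAct_mem_strand _ hz S).1,
    Submodule.sum_mem _ fun i _ => ?_⟩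
  have := smul_mem_freePiece (X_mem_polyPiece i) (Λ.matAct_mem_strand (Λ.annih i) hz S).2
  rwa [sub_add_cancel] at this

theorem lin_smul_mem_strand {a : Fin n → ℂ} (h : ∀ m ∈ Z', lin a • m ∈ Z)
    {z : Λ.idx → Fin s → MvPolynomial (Fin n) ℂ} (hz : z ∈ Λ.strand c Z' (t - 1)) :
    lin a • z ∈ Λ.strand c Z t := fun S => by
  have := smul_mem_freePiece (lin_mem_polyPiece a) (hz S).2
  rw [sub_add_cancel] at this
  exact ⟨h _ (hz S).1, this⟩

/-- The Koszul homology of the graded submodule `Z` of `⨁ₖ R(-cₖ)` with coefficients of degree `t`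
vanishes for `t > r`, which says that `Z` is `r`-regular. -/
def KoszulRegular (c : Fin s → ℤ)
    (Z : Submodule (MvPolynomial (Fin n) ℂ) (Fin s → MvPolynomial (Fin n) ℂ)) (r : ℤ) : Prop :=
  ∀ t > r, ∀ z ∈ Λ.strand c Z t, Λ.kos z = 0 → ∃ w ∈ Λ.strand c Z (t - 1), Λ.kos w = z

theorem eq_zero_of_lin_smul {a : Fin n → ℂ} (ha : lin a ≠ 0)
    {z : Λ.idx → Fin s → MvPolynomial (Fin n) ℂ} (h : lin a • z = 0) : z = 0 := by
  ext1 S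
  ext1 k
  have := congrFun (congrFun h S) k
  simpa [ha] using this

/-! ### Products of annihilation operators -/

section AnnList

variable {F : Type*} [AddCommGroup F] [Module (MvPolynomial (Fin n) ℂ) F]

/-- A product of contractions. -/
def annList : List (Fin n → ℂ) → (Λ.idx → F) → (Λ.idx → F)
  | [], z => z
  | v :: l, z => Λ.ann v (annList l z)

theorem annList_zero (l : List (Fin n → ℂ)) : Λ.annList l (0 : Λ.idx → F) = 0 := by
  induction l with
  | nil => rfl
  | cons v l ih => rw [annList, ih, map_zero]

theorem annList_neg (l : List (Fin n → ℂ)) (z : Λ.idx → F) :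
    Λ.annList l (-z) = -Λ.annList l z := by
  induction l with
  | nil => rfl
  | cons v l ih => rw [annList, annList, ih, map_neg]

theorem annList_add (l : List (Fin n → ℂ)) (z w : Λ.idx → F) :
    Λ.annList l (z + w) = Λ.annList l z + Λ.annList l w := by
  induction l with
  | nil => rfl
  | cons v l ih => rw [annList, annList, annList, ih, map_add]

theorem annList_sub (l : List (Fin n → ℂ)) (z w : Λ.idx → F) :
    Λ.annList l (z - w) = Λ.annList l z - Λ.annList l w := by
  rw [sub_eq_add_neg, annList_add, annList_neg, sub_eq_add_neg]

theorem annList_smul (l : List (Fin n → ℂ)) (p : MvPolynomial (Fin n) ℂ) (z : Λ.idx → F) :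
    Λ.annList l (p • z) = p • Λ.annList l z := by
  induction l with
  | nil => rfl
  | cons v l ih => rw [annList, annList, ih, map_smul]

theorem annList_sum {κ : Type*} (T : Finset κ) (l : List (Fin n → ℂ)) (z : κ → Λ.idx → F) :
    Λ.annList l (∑ k ∈ T, z k) = ∑ k ∈ T, Λ.annList l (z k) := by
  classical
  induction T using Finset.induction_on with
  | empty => simp [annList_zero]
  | insert k T hk ih => rw [Finset.sum_insert hk, Finset.sum_insert hk, annList_add, ih]

theorem kos_annList (l : List (Fin n → ℂ)) (z : Λ.idx → F) :
    Λ.kos (Λ.annList l z) = (-1 : ℤ) ^ l.length • Λ.annList l (Λ.kos z) := by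
  induction l with
  | nil => simp [annList]
  | cons v l ih =>
    rw [annList, annList, kos_ann, ih, map_zsmul, List.length_cons, pow_succ, mul_neg_one, neg_smul]

theorem ann_annList (l : List (Fin n → ℂ)) (v : Fin n → ℂ) (z : Λ.idx → F) :
    Λ.ann v (Λ.annList l z) = (-1 : ℤ) ^ l.length • Λ.annList l (Λ.ann v z) := by
  induction l with
  | nil => simp [annList]
  | cons u l ih =>
    rw [annList, annList, ann_ann, ih, map_zsmul, List.length_cons, pow_succ, mul_neg_one, neg_smul]

theorem annList_cre (l : List (Fin n → ℂ)) {a : Fin n → ℂ} (ha : ∀ v ∈ l, a ⬝ᵥ v = 0)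
    (z : Λ.idx → F) :
    Λ.annList l (Λ.cre a z) = (-1 : ℤ) ^ l.length • Λ.cre a (Λ.annList l z) := by
  induction l with
  | nil => simp [annList]
  | cons u l ih =>
    rw [annList, annList, ih fun v hv => ha v (List.mem_cons_of_mem _ hv), map_zsmul,
      ann_cre_of_zero _ (ha u List.mem_cons_self), List.length_cons, pow_succ, mul_neg_one,
      neg_smul, smul_neg]

theorem annList_ann_of_mem (l : List (Fin n → ℂ)) {v : Fin n → ℂ} (hv : v ∈ l) (z : Λ.idx → F) :
    Λ.annList l (Λ.ann v z) = 0 := by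
  induction l with
  | nil => simp at hv
  | cons u l ih =>
    rw [annList]
    rcases List.mem_cons.1 hv with rfl | h
    · have := Λ.ann_annList l v z
      have h2 : Λ.annList l (Λ.ann v z) = (-1 : ℤ) ^ l.length • Λ.ann v (Λ.annList l z) := by
        rw [this, smul_smul, ← mul_pow]; simp
      rw [h2, map_zsmul, ann_ann_self, smul_zero]
    · rw [ih h, map_zero]

end AnnList

theorem annList_mem_strand (l : List (Fin n → ℂ)) {z : Λ.idx → Fin s → MvPolynomial (Fin n) ℂ}
    (hz : z ∈ Λ.strand c Z t) : Λ.annList l z ∈ Λ.strand c Z t := by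
  induction l with
  | nil => exact hz
  | cons v l ih => exact Λ.ann_mem_strand v ih

/-! ### Regularity by approximation -/

/-- If multiplication by the linear form `a` maps a regular module `Z' ⊇ Z` into `Z`, then on the
Koszul homology of `Z` in high degrees, contraction with a vector `v` such that `a(v) = 1` has a
one-sided inverse; so it can be cancelled. -/
theorem annList_boundary_of_cons {r : ℤ} (hr : Λ.KoszulRegular c Z' r) (hZ : Z ≤ Z')
    {a v : Fin n → ℂ} (haZ : ∀ m ∈ Z', lin a • m ∈ Z) (hav : a ⬝ᵥ v = 1)
    {l : List (Fin n → ℂ)} (hal : ∀ u ∈ l, a ⬝ᵥ u = 0) (ht : r + 2 ≤ t)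
    (h : ∀ z ∈ Λ.strand c Z t, Λ.kos z = 0 →
      ∃ b ∈ Λ.strand c Z (t - 1), Λ.kos b = Λ.annList (v :: l) z)
    (z : Λ.idx → Fin s → MvPolynomial (Fin n) ℂ) (hz : z ∈ Λ.strand c Z t) (hz0 : Λ.kos z = 0) :
    ∃ b ∈ Λ.strand c Z (t - 1), Λ.kos b = Λ.annList l z := by
  obtain ⟨w, hw, rfl⟩ := hr t (by linarith) z (Λ.strand_mono hZ hz) hz0
  set z := Λ.kos w with hzdef
  -- Although `w` only has coefficients in `Z'`, this is a cycle with coefficients in `Z`: both of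
  -- its terms have boundary `lin a • z`.
  obtain ⟨b₁, hb₁, e₁⟩ := h (lin a • w - Λ.cre a z)
    (sub_mem (Λ.lin_smul_mem_strand haZ hw) (Λ.cre_mem_strand a hz)) (by
      rw [map_sub, map_smul, ← hzdef, kos_cre, hz0, map_zero, sub_zero, sub_self])
  obtain ⟨b₂, hb₂, e₂⟩ := h z hz hz0
  set ε : ℤ := (-1) ^ l.length with hε
  have hεε : ε * ε = 1 := by rw [hε, ← mul_pow]; simp
  have hq : Λ.kos (Λ.annList (v :: l) w + ε • b₂) = 0 := by
    rw [map_add, kos_annList, ← hzdef, map_zsmul, e₂, List.length_cons, pow_succ, mul_neg_one,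
      neg_smul, neg_add_cancel]
  -- Regularity of `Z'` is used a second time, now in degree `t - 1`; hence the assumption `r + 2 ≤
  -- t`.
  obtain ⟨c', hc', e₃⟩ := hr (t - 1) (by linarith) _
    (add_mem (Λ.annList_mem_strand _ hw) (zsmul_mem (Λ.strand_mono hZ hb₂) ε)) hq
  have e₄ : Λ.kos b₁ = lin a • Λ.annList (v :: l) w - ε • (Λ.annList l z - Λ.cre a (Λ.kos b₂)) := by
    rw [e₁, annList_sub, annList_smul]
    congr 1
    rw [e₂, annList, annList_cre _ _ hal, map_zsmul, ann_cre_of_one _ hav, annList]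
  have e₅ : Λ.cre a (Λ.kos b₂) = lin a • b₂ - Λ.kos (Λ.cre a b₂) := by
    rw [kos_cre]; abel
  refine ⟨ε • (lin a • c' - ε • Λ.cre a b₂ - b₁), zsmul_mem (sub_mem (sub_mem
    (Λ.lin_smul_mem_strand haZ hc') (zsmul_mem (Λ.cre_mem_strand a hb₂) ε)) hb₁) ε, ?_⟩
  rw [map_zsmul, map_sub, map_sub, map_smul, e₃, map_zsmul, e₄, e₅, smul_add,
    smul_comm (lin a) ε b₂]
  simp only [smul_sub, smul_add, smul_smul, hεε, one_smul]
  abel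

/-- **Regularity by approximation.** -/
theorem exists_boundary_of_annList {κ : Type*} {r : ℤ} {b v : κ → Fin n → ℂ}
    {Y : κ → Submodule (MvPolynomial (Fin n) ℂ) (Fin s → MvPolynomial (Fin n) ℂ)}
    (hdual : ∀ k, b k ⬝ᵥ v k = 1) (hdual' : ∀ k k', k ≠ k' → b k ⬝ᵥ v k' = 0)
    (ht : r + 2 ≤ t) (l : List κ) (hl : l.Nodup)
    (hreg : ∀ k ∈ l, Λ.KoszulRegular c (Y k) r) (hle : ∀ k ∈ l, Z ≤ Y k)
    (hb : ∀ k ∈ l, ∀ m ∈ Y k, lin (b k) • m ∈ Z)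
    (h : ∀ z ∈ Λ.strand c Z t, Λ.kos z = 0 →
      ∃ b ∈ Λ.strand c Z (t - 1), Λ.kos b = Λ.annList (l.map v) z) :
    ∀ z ∈ Λ.strand c Z t, Λ.kos z = 0 → ∃ b ∈ Λ.strand c Z (t - 1), Λ.kos b = z := by
  induction l with
  | nil => exact h
  | cons k l ih =>
    refine ih (List.nodup_cons.1 hl).2 (fun j hj => hreg j (List.mem_cons_of_mem _ hj))
      (fun j hj => hle j (List.mem_cons_of_mem _ hj)) (fun j hj => hb j (List.mem_cons_of_mem _ hj))
      ?_
    refine Λ.annList_boundary_of_cons (hreg k List.mem_cons_self) (hle k List.mem_cons_self)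
      (hb k List.mem_cons_self) (hdual k) ?_ ht h
    intro u hu
    obtain ⟨j, hj, rfl⟩ := List.mem_map.1 hu
    exact hdual' _ _ fun hkj => (List.nodup_cons.1 hl).1 (hkj ▸ hj)

/-! ### Eliminating a variable from Koszul cycles -/

/-- The substitution `hypProj a w` applied to the coefficients of a Koszul chain. -/
def projChain (a w : Fin n → ℂ) (z : Λ.idx → Fin s → MvPolynomial (Fin n) ℂ) :
    Λ.idx → Fin s → MvPolynomial (Fin n) ℂ := fun S k => hypProj a w (z S k)

theorem projChain_add (a w : Fin n → ℂ) (z z' : Λ.idx → Fin s → MvPolynomial (Fin n) ℂ) :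
    Λ.projChain a w (z + z') = Λ.projChain a w z + Λ.projChain a w z' := by
  ext1 S; ext1 k; simp [projChain]

theorem projChain_matAct (a w : Fin n → ℂ) (A : Matrix Λ.idx Λ.idx ℂ)
    (z : Λ.idx → Fin s → MvPolynomial (Fin n) ℂ) :
    Λ.projChain a w (Λ.matAct A z) = Λ.matAct A (Λ.projChain a w z) := by
  ext1 S; ext1 k
  simp [projChain, matAct_apply]

theorem projChain_ann (a w v : Fin n → ℂ) (z : Λ.idx → Fin s → MvPolynomial (Fin n) ℂ) :
    Λ.projChain a w (Λ.ann v z) = Λ.ann v (Λ.projChain a w z) := Λ.projChain_matAct _ _ _ _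

/-- Replacing `X i` by `X i - w i * lin a` in the Koszul differential subtracts `lin a` times
contraction with `w`. On chains killed by that contraction, projection therefore commutes with the
differential. -/
theorem projChain_kos (a w : Fin n → ℂ) (z : Λ.idx → Fin s → MvPolynomial (Fin n) ℂ) :
    Λ.projChain a w (Λ.kos z) =
      Λ.kos (Λ.projChain a w z) - lin a • Λ.ann w (Λ.projChain a w z) := by
  ext1 S; ext1 k
  have h : ∀ i, hypProj a w (Λ.matAct (Λ.annih i) z S k) =
      Λ.matAct (Λ.annih i) (Λ.projChain a w z) S k :=
    fun i => congrFun (congrFun (Λ.projChain_matAct a w (Λ.annih i) z) S) k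
  have h1 : Λ.projChain a w (Λ.kos z) S k =
      ∑ i, (X i - C (w i) * lin a) * Λ.matAct (Λ.annih i) (Λ.projChain a w z) S k := by
    rw [projChain, kos_apply, Finset.sum_apply, map_sum]
    refine Finset.sum_congr rfl fun i _ => ?_
    rw [Pi.smul_apply, smul_eq_mul, map_mul, hypProj_X, h]
  rw [h1, Pi.sub_apply, Pi.sub_apply, Pi.smul_apply, Pi.smul_apply, kos_apply, ann_apply,
    Finset.sum_apply, Finset.sum_apply, smul_eq_mul, Finset.mul_sum, ← Finset.sum_sub_distrib]
  refine Finset.sum_congr rfl fun i _ => ?_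
  rw [Pi.smul_apply, Pi.smul_apply, smul_eq_mul, smul_eq_mul]
  ring

theorem projChain_projChain {a w : Fin n → ℂ} (h : a ⬝ᵥ w = 1)
    (z : Λ.idx → Fin s → MvPolynomial (Fin n) ℂ) :
    Λ.projChain a w (Λ.projChain a w z) = Λ.projChain a w z := by
  ext1 S; ext1 k
  simp [projChain, hypProj_hypProj h]

theorem projChain_lin_smul {a w : Fin n → ℂ} (h : a ⬝ᵥ w = 1)
    (z : Λ.idx → Fin s → MvPolynomial (Fin n) ℂ) : Λ.projChain a w (lin a • z) = 0 := by
  ext1 S; ext1 k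
  simp [projChain, hypProj_lin_self h]

/-- A Koszul cycle is homologous to one in which the variable `a` does not occur. -/
theorem exists_boundary_sub_projChain {a w : Fin n → ℂ} (haw : a ⬝ᵥ w = 1)
    (hproj : ∀ m ∈ Z, (fun k => hypProj a w (m k)) ∈ Z) (hdiv : ∀ m, lin a • m ∈ Z → m ∈ Z)
    {z : Λ.idx → Fin s → MvPolynomial (Fin n) ℂ} (hz : z ∈ Λ.strand c Z t) (hz0 : Λ.kos z = 0) :
    Λ.projChain a w (Λ.ann w (Λ.cre a z)) ∈ Λ.strand c Z t ∧
      ∃ b ∈ Λ.strand c Z (t - 1),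
        Λ.kos b = z - Λ.projChain a w (Λ.ann w (Λ.cre a z)) := by
  have ha0 := lin_ne_zero_of_dotProduct haw
  -- Split `z = x + a ∧ y` with `x` and `y` killed by contraction with `w`.
  set x := Λ.ann w (Λ.cre a z) with hx
  set y := Λ.ann w z with hy
  have hxZ : x ∈ Λ.strand c Z t := Λ.ann_mem_strand _ (Λ.cre_mem_strand _ hz)
  have hzxy : z = x + Λ.cre a y := by rw [hx, hy, ann_cre_of_one _ haw, sub_add_cancel]
  have hax : Λ.ann w x = 0 := ann_ann_self _ _ _
  have hay : Λ.ann w y = 0 := ann_ann_self _ _ _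
  have hpx : Λ.projChain a w x ∈ Λ.strand c Z t := fun S =>
    ⟨hproj _ (hxZ S).1, mem_freePiece.2 fun k =>
      hypProj_mem_polyPiece _ _ (mem_freePiece.1 (hxZ S).2 k)⟩
  refine ⟨hpx, ?_⟩
  choose q hq using fun S k => lin_dvd_sub_hypProj a w (x S k)
  have hq' : lin a • q = x - Λ.projChain a w x := by
    ext1 S; ext1 k
    simp [projChain, hq]
  have hqZ : q ∈ Λ.strand c Z (t - 1) := fun S => by
    have h1 : lin a • q S ∈ Z ∧ lin a • q S ∈ freePiece c t := by
      rw [show lin a • q S = (lin a • q) S from rfl, hq']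
      exact sub_mem hxZ hpx S
    refine ⟨hdiv _ h1.1, mem_freePiece_of_smul_mem (lin_mem_polyPiece a) ha0 ?_⟩
    rw [sub_add_cancel]
    exact h1.2
  have haq : Λ.ann w q = 0 := Λ.eq_zero_of_lin_smul ha0 (by
    rw [← map_smul, hq', map_sub, ← projChain_ann, hax]
    ext1 S; ext1 k
    simp [projChain])
  -- Subtracting the boundary of `a ∧ q` replaces `x` by its projection and `y` by `y'`; the cycle
  -- condition will force `y' = 0`.
  set y' := y + Λ.kos q with hy'
  have hay' : Λ.ann w y' = 0 := by
    rw [hy', map_add, hay, zero_add, ← neg_eq_zero, ← kos_ann, haq, map_zero]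
  have e1 : z - Λ.kos (Λ.cre a q) = Λ.projChain a w x + Λ.cre a y' := by
    rw [kos_cre, hq', hzxy, hy', map_add]; abel
  have hapx : Λ.ann w (Λ.projChain a w x) = 0 := by
    rw [← projChain_ann, hax]
    ext1 S; ext1 k
    simp [projChain]
  have e2 : Λ.kos (Λ.projChain a w x) + lin a • y' = Λ.cre a (Λ.kos y') := by
    have h1 := congrArg Λ.kos e1
    rw [map_sub, hz0, kos_kos, sub_zero, map_add, kos_cre] at h1
    rw [← sub_eq_zero, h1]; abel
  -- Contraction with `w` isolates the part of `e2` containing `a`.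
  have e3 : Λ.kos y' = 0 := by
    have h1 := congrArg (Λ.ann w) e2
    rw [map_add, map_smul, hay', smul_zero, add_zero, ann_cre_of_one _ haw] at h1
    have h2 : ∀ u : Λ.idx → Fin s → MvPolynomial (Fin n) ℂ, Λ.ann w u = 0 →
        Λ.ann w (Λ.kos u) = 0 := fun u hu => by
      rw [← neg_eq_zero, ← kos_ann, hu, map_zero]
    rw [h2 _ hapx, h2 _ hay', map_zero, sub_zero] at h1
    exact h1.symm
  rw [e3, map_zero] at e2
  have e4 : Λ.projChain a w (Λ.kos (Λ.projChain a w x)) = Λ.kos (Λ.projChain a w x) := by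
    rw [projChain_kos, projChain_projChain _ haw, hapx, smul_zero, sub_zero]
  -- In what is left of `e2`, the first term is fixed by the projection and `lin a • y'` is killed
  -- by it, so both vanish.
  have e5 : y' = 0 := Λ.eq_zero_of_lin_smul ha0 (by
    have h1 := congrArg (Λ.projChain a w) e2
    rw [projChain_add, e4, projChain_lin_smul _ haw, add_zero] at h1
    have h2 : Λ.projChain a w (0 : Λ.idx → Fin s → MvPolynomial (Fin n) ℂ) = 0 := by
      ext1 S; ext1 k; simp [projChain]
    rw [h2] at h1
    rwa [h1, zero_add] at e2)
  refine ⟨Λ.cre a q, Λ.cre_mem_strand _ hqZ, ?_⟩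
  rw [e5, map_zero, add_zero] at e1
  rw [← e1]; abel

theorem ann_projChain_self (a w : Fin n → ℂ) (z : Λ.idx → Fin s → MvPolynomial (Fin n) ℂ) :
    Λ.ann w (Λ.projChain a w (Λ.ann w (Λ.cre a z))) = 0 := by
  rw [← projChain_ann, ann_ann_self]
  ext1 S; ext1 k
  simp [projChain]

/-- Eliminating one variable does not undo the eliminations already made. -/
theorem ann_projChain_of_zero {a u : Fin n → ℂ} (w : Fin n → ℂ) (hau : a ⬝ᵥ u = 0)
    {z : Λ.idx → Fin s → MvPolynomial (Fin n) ℂ} (hz : Λ.ann u z = 0) :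
    Λ.ann u (Λ.projChain a w (Λ.ann w (Λ.cre a z))) = 0 := by
  rw [← projChain_ann, ann_ann, ann_cre_of_zero _ hau, hz, map_zero, neg_zero, map_zero, neg_zero]
  ext1 S; ext1 k
  simp [projChain]

/-- Several variables can be eliminated at once from a Koszul cycle. -/
theorem exists_homologous_ann_eq_zero {κ : Type*} {b v : κ → Fin n → ℂ}
    (hdual : ∀ k, b k ⬝ᵥ v k = 1) (hdual' : ∀ k k', k ≠ k' → b k ⬝ᵥ v k' = 0) (l : List κ)
    (hproj : ∀ k ∈ l, ∀ m ∈ Z, (fun i => hypProj (b k) (v k) (m i)) ∈ Z)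
    (hdiv : ∀ k ∈ l, ∀ m, lin (b k) • m ∈ Z → m ∈ Z)
    {z : Λ.idx → Fin s → MvPolynomial (Fin n) ℂ} (hz : z ∈ Λ.strand c Z t) (hz0 : Λ.kos z = 0) :
    ∃ z' ∈ Λ.strand c Z t, (∀ k ∈ l, Λ.ann (v k) z' = 0) ∧
      ∃ w ∈ Λ.strand c Z (t - 1), Λ.kos w = z - z' := by
  classical
  induction l with
  | nil => exact ⟨z, hz, by simp, 0, zero_mem _, by simp⟩
  | cons k l ih =>
    obtain ⟨z₁, hz₁, h₁, w₁, hw₁, e₁⟩ := ih (fun j hj => hproj j (List.mem_cons_of_mem _ hj))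
      fun j hj => hdiv j (List.mem_cons_of_mem _ hj)
    have hz₁0 : Λ.kos z₁ = 0 := by
      rw [show z₁ = z - Λ.kos w₁ by rw [e₁]; abel, map_sub, hz0, kos_kos, sub_zero]
    obtain ⟨h₂, w₂, hw₂, e₂⟩ := Λ.exists_boundary_sub_projChain (hdual k)
      (hproj k List.mem_cons_self) (hdiv k List.mem_cons_self) hz₁ hz₁0
    refine ⟨_, h₂, fun j hj => ?_, w₁ + w₂, add_mem hw₁ hw₂, by rw [map_add, e₁, e₂]; abel⟩
    by_cases hjk : j = k
    · rw [hjk]; exact Λ.ann_projChain_self _ _ _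
    · exact Λ.ann_projChain_of_zero _ (hdual' k j fun h => hjk h.symm)
        (h₁ j ((List.mem_cons.1 hj).resolve_left hjk))

/-! ### Free modules -/

theorem hypProj_single_mem_supported {T : Set (Fin n)} (i : Fin n) {p : MvPolynomial (Fin n) ℂ}
    (hp : p ∈ supported ℂ T) :
    hypProj (Pi.single i 1) (Pi.single i 1) p ∈ supported ℂ (T \ {i}) := by
  rw [supported_eq_adjoin_X] at hp
  induction hp using Algebra.adjoin_induction with
  | mem x hx =>
    obtain ⟨j, hj, rfl⟩ := hx
    rw [hypProj_X, lin_single]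
    by_cases hji : j = i
    · subst hji; simp
    · rw [Pi.single_eq_of_ne hji, C_0, zero_mul, sub_zero]
      exact X_mem_supported.2 ⟨hj, hji⟩
  | algebraMap r => rw [AlgHom.commutes]; exact Subalgebra.algebraMap_mem _ r
  | add x y _ _ hx hy => rw [map_add]; exact add_mem hx hy
  | mul x y _ _ hx hy => rw [map_mul]; exact mul_mem hx hy

theorem exists_homologous_supported (l : List (Fin n))
    {z : Λ.idx → Fin s → MvPolynomial (Fin n) ℂ} (hz : z ∈ Λ.strand c ⊤ t) (hz0 : Λ.kos z = 0) :
    ∃ z' ∈ Λ.strand c ⊤ t, (∀ S k, z' S k ∈ supported ℂ {i | i ∉ l}) ∧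
      ∃ w ∈ Λ.strand c ⊤ (t - 1), Λ.kos w = z - z' := by
  induction l with
  | nil => exact ⟨z, hz, by simp, 0, zero_mem _, by simp⟩
  | cons i l ih =>
    obtain ⟨z₁, hz₁, h₁, w₁, hw₁, e₁⟩ := ih
    have hz₁0 : Λ.kos z₁ = 0 := by
      rw [show z₁ = z - Λ.kos w₁ by rw [e₁]; abel, map_sub, hz0, kos_kos, sub_zero]
    obtain ⟨h₂, w₂, hw₂, e₂⟩ := Λ.exists_boundary_sub_projChain (a := Pi.single i 1)
      (w := Pi.single i 1) (by simp) (fun _ _ => Submodule.mem_top)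
      (fun _ _ => Submodule.mem_top) hz₁ hz₁0
    refine ⟨_, h₂, fun S k => ?_, w₁ + w₂, add_mem hw₁ hw₂, by rw [map_add, e₁, e₂]; abel⟩
    have h3 : {j | j ∉ i :: l} = {j | j ∉ l} \ {i} := by
      ext j; simp; tauto
    rw [h3]
    refine hypProj_single_mem_supported i ?_
    have h4 : ∀ (A : Matrix Λ.idx Λ.idx ℂ) (y : Λ.idx → Fin s → MvPolynomial (Fin n) ℂ),
        (∀ S k, y S k ∈ supported ℂ {j | j ∉ l}) →
          ∀ S k, Λ.matAct A y S k ∈ supported ℂ {j | j ∉ l} := fun A y hy S k => by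
      rw [matAct_apply, Finset.sum_apply]
      exact Subalgebra.sum_mem _ fun T _ =>
        mul_mem (Subalgebra.algebraMap_mem _ _) (hy T k)
    exact h4 _ _ (h4 _ _ h₁) S k

/-- A graded free module is as regular as its generators. -/
theorem koszulRegular_top {r : ℤ} (hc : ∀ k, c k ≤ r) : Λ.KoszulRegular c ⊤ r := by
  intro t ht z hz hz0
  obtain ⟨z', hz', h, w, hw, e⟩ := Λ.exists_homologous_supported (List.finRange n) hz hz0
  -- With all variables gone the coefficients are constants, which vanish because `t - c k > 0`.
  have h0 : z' = 0 := by
    ext1 S; ext1 k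
    have h1 := h S k
    simp only [List.mem_finRange, not_true_eq_false, Set.ofPred_false, supported_empty] at h1
    obtain ⟨a, ha⟩ := Algebra.mem_bot.1 h1
    have h2 := coeff_zero_eq_zero_of_mem_polyPiece (mem_freePiece.1 (hz' S).2 k)
      (by have := hc k; omega)
    rw [← ha, algebraMap_eq, constantCoeff_C] at h2
    rw [← ha, h2, map_zero]; rfl
  exact ⟨w, hw, by rw [e, h0, sub_zero]⟩

end ExteriorModel

/-! ### The module of logarithmic vector fields of a set of linear forms -/

section LogModule

variable {n : ℕ}

theorem exists_dotProduct_eq_one {a : Fin n → ℂ} (ha : a ≠ 0) : ∃ w, a ⬝ᵥ w = 1 := by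
  obtain ⟨i, hi⟩ := Function.ne_iff.1 ha
  exact ⟨Pi.single i (a i)⁻¹, by rw [dotProduct_single]; exact mul_inv_cancel₀ hi⟩

theorem lin_ne_zero {a : Fin n → ℂ} (ha : a ≠ 0) : lin a ≠ 0 :=
  lin_ne_zero_of_dotProduct (exists_dotProduct_eq_one ha).choose_spec

theorem lin_dvd_iff_hypProj_eq_zero {a w : Fin n → ℂ} (h : a ⬝ᵥ w = 1)
    {p : MvPolynomial (Fin n) ℂ} : lin a ∣ p ↔ hypProj a w p = 0 := by
  constructor
  · rintro ⟨q, rfl⟩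
    rw [map_mul, hypProj_lin_self h, zero_mul]
  · intro hp
    simpa [hp] using lin_dvd_sub_hypProj a w p

/-- `lin a` generates the kernel of the substitution `hypProj a w`, an endomorphism of a domain. -/
theorem prime_lin {a : Fin n → ℂ} (ha : a ≠ 0) : Prime (lin a) := by
  obtain ⟨w, hw⟩ := exists_dotProduct_eq_one ha
  refine ⟨lin_ne_zero ha, fun hu => ?_, fun p q hpq => ?_⟩
  · have h1 := (lin_dvd_iff_hypProj_eq_zero hw).1 (isUnit_iff_dvd_one.1 hu)
    simp at h1
  · simp only [lin_dvd_iff_hypProj_eq_zero hw, map_mul, mul_eq_zero] at hpq ⊢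
    exact hpq

/-- The value of a vector field, given by its coefficients, on the linear form `a`. -/
def linDer (a : Fin n → ℂ) :
    (Fin n → MvPolynomial (Fin n) ℂ) →ₗ[MvPolynomial (Fin n) ℂ] MvPolynomial (Fin n) ℂ :=
  ∑ i, (C (a i) : MvPolynomial (Fin n) ℂ) • LinearMap.proj i

theorem linDer_apply (a : Fin n → ℂ) (θ : Fin n → MvPolynomial (Fin n) ℂ) :
    linDer a θ = ∑ i, C (a i) * θ i := by
  simp [linDer]

theorem linDer_mem_polyPiece {a : Fin n → ℂ} {θ : Fin n → MvPolynomial (Fin n) ℂ} {t : ℤ}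
    (hθ : θ ∈ freePiece (fun _ => -1) t) : linDer a θ ∈ polyPiece n (t + 1) := by
  rw [linDer_apply]
  refine Submodule.sum_mem _ fun i _ => C_mul_mem_polyPiece _ ?_
  simpa using mem_freePiece.1 hθ i

/-- The coefficients of the vector field `p ∂_v`. -/
def constField (v : Fin n → ℂ) (p : MvPolynomial (Fin n) ℂ) : Fin n → MvPolynomial (Fin n) ℂ :=
  fun i => C (v i) * p

theorem linDer_constField (a v : Fin n → ℂ) (p : MvPolynomial (Fin n) ℂ) :
    linDer a (constField v p) = C (a ⬝ᵥ v) * p := by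
  simp only [linDer_apply, constField, dotProduct, map_sum, map_mul, Finset.sum_mul, mul_assoc]

theorem constField_mem_freePiece {v : Fin n → ℂ} {p : MvPolynomial (Fin n) ℂ} {t : ℤ}
    (hp : p ∈ polyPiece n (t + 1)) : constField v p ∈ freePiece (fun _ => -1) t :=
  mem_freePiece.2 fun i => C_mul_mem_polyPiece _ (by simpa using hp)

variable {ι : Type*}

/-- The vector fields that are logarithmic along each of the hyperplanes `aᵢ = 0`, `i ∈ B`. -/
def logModule (a : ι → Fin n → ℂ) (B : Finset ι) :
    Submodule (MvPolynomial (Fin n) ℂ) (Fin n → MvPolynomial (Fin n) ℂ) where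
  carrier := {θ | ∀ i ∈ B, lin (a i) ∣ linDer (a i) θ}
  add_mem' hθ hη i hi := by rw [map_add]; exact dvd_add (hθ i hi) (hη i hi)
  zero_mem' i _ := by simp
  smul_mem' p θ hθ i hi := by
    rw [map_smul, smul_eq_mul]; exact dvd_mul_of_dvd_right (hθ i hi) _

theorem mem_logModule {a : ι → Fin n → ℂ} {B : Finset ι} {θ : Fin n → MvPolynomial (Fin n) ℂ} :
    θ ∈ logModule a B ↔ ∀ i ∈ B, lin (a i) ∣ linDer (a i) θ := Iff.rfl

theorem logModule_mono (a : ι → Fin n → ℂ) {B B' : Finset ι} (h : B' ⊆ B) :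
    logModule a B ≤ logModule a B' := fun _ hθ i hi => hθ i (h hi)

theorem lin_smul_mem_logModule [DecidableEq ι] {a : ι → Fin n → ℂ} {B : Finset ι} (j : ι)
    {θ : Fin n → MvPolynomial (Fin n) ℂ} (hθ : θ ∈ logModule a (B.erase j)) :
    lin (a j) • θ ∈ logModule a B := fun i hi => by
  rw [map_smul, smul_eq_mul]
  by_cases hij : i = j
  · rw [hij]; exact dvd_mul_right _ _
  · exact dvd_mul_of_dvd_right (hθ i (Finset.mem_erase.2 ⟨hij, hi⟩)) _

/-- The forms in `B` are constant along `v`, so the substitution fixes them and preserves the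
divisibility conditions. -/
theorem hypProj_mem_logModule {a : ι → Fin n → ℂ} {B : Finset ι} {b v : Fin n → ℂ}
    (hv : ∀ i ∈ B, a i ⬝ᵥ v = 0) {θ : Fin n → MvPolynomial (Fin n) ℂ} (hθ : θ ∈ logModule a B) :
    (fun k => hypProj b v (θ k)) ∈ logModule a B := fun i hi => by
  obtain ⟨q, hq⟩ := hθ i hi
  refine ⟨hypProj b v q, ?_⟩
  have h := congrArg (hypProj b v) hq
  rw [map_mul, hypProj_lin_of_dotProduct_zero (hv i hi), linDer_apply, map_sum] at h
  rw [linDer_apply, ← h]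
  simp only [map_mul, hypProj_C]

/-- Evaluation at `v` shows that no prime `lin (a i)` with `i ∈ B` divides `lin b`, so `lin b` can
be cancelled. -/
theorem mem_logModule_of_lin_smul_mem {a : ι → Fin n → ℂ} {B : Finset ι} (ha : ∀ i, a i ≠ 0)
    {b v : Fin n → ℂ} (hbv : b ⬝ᵥ v = 1) (hv : ∀ i ∈ B, a i ⬝ᵥ v = 0)
    {θ : Fin n → MvPolynomial (Fin n) ℂ} (hθ : lin b • θ ∈ logModule a B) :
    θ ∈ logModule a B := fun i hi => by
  have h := hθ i hi
  rw [map_smul, smul_eq_mul] at h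
  refine ((prime_lin (ha i)).2.2 _ _ h).resolve_left fun ⟨q, hq⟩ => ?_
  have h1 := congrArg (eval v) hq
  rw [map_mul, eval_lin, eval_lin, hbv, hv i hi, zero_mul] at h1
  exact one_ne_zero h1

end LogModule

/-- A basis of `ℂⁿ` and its dual basis, adapted to a set `T` of vectors: each member of the basis
lies in `T` or the dual vector is orthogonal to `T`. -/
theorem exists_adapted_dual_bases {n : ℕ} (T : Set (Fin n → ℂ)) :
    ∃ (κ : Type) (_ : Fintype κ) (b v : κ → Fin n → ℂ), (∀ k, b k ⬝ᵥ v k = 1) ∧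
      (∀ k k', k ≠ k' → b k ⬝ᵥ v k' = 0) ∧
      (∀ i j, ∑ k, b k i * v k j = if i = j then 1 else 0) ∧
      ∀ k, b k ∈ T ∨ ∀ x ∈ T, x ⬝ᵥ v k = 0 := by
  classical
  obtain ⟨s, hsT, hspan, hs⟩ := exists_linearIndependent ℂ T
  have hs' : LinearIndepOn ℂ id s := hs
  set β := Module.Basis.extend hs' with hβ
  have hβe : ∀ k, β k = (k : Fin n → ℂ) := Module.Basis.extend_apply_self hs'
  let _ : Fintype (hs'.extend (Set.subset_univ s)) := FiniteDimensional.fintypeBasisIndex β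
  set v : hs'.extend (Set.subset_univ s) → Fin n → ℂ :=
    fun k j => β.repr (Pi.single j 1) k with hv
  have hdot : ∀ (x : Fin n → ℂ) k, x ⬝ᵥ v k = β.repr x k := fun x k => by
    conv_rhs => rw [pi_eq_sum_univ' x]
    simp only [map_sum, map_smul, Finsupp.coe_finsetSum, Finset.sum_apply, Finsupp.smul_apply,
      smul_eq_mul]
    rfl
  refine ⟨hs'.extend (Set.subset_univ s), inferInstance, β, v, fun k => ?_, fun k k' h => ?_,
    fun i j => ?_, fun k => ?_⟩
  · rw [hdot, β.repr_self, Finsupp.single_eq_same]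
  · rw [hdot, β.repr_self, Finsupp.single_eq_of_ne h.symm]
  · have h := congrFun (β.sum_repr (Pi.single j 1)) i
    rw [Finset.sum_apply, Pi.single_apply] at h
    rw [← h]
    refine Finset.sum_congr rfl fun k _ => ?_
    rw [Pi.smul_apply, smul_eq_mul, mul_comm]
  · by_cases hk : β k ∈ T
    · exact Or.inl hk
    · refine Or.inr fun x hx => ?_
      have hx' : x ∈ Submodule.span ℂ s := hspan ▸ Submodule.subset_span hx
      -- A basis vector outside `T` is not in `s`, so its coordinate functional vanishes on `s`,
      -- which spans the same space as `T`.
      have hle : Submodule.span ℂ s ≤ LinearMap.ker (β.coord k) := by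
        refine Submodule.span_le.2 fun y hy => ?_
        have hy' : y = β ⟨y, Module.Basis.subset_extend hs' hy⟩ :=
          (hβe ⟨y, Module.Basis.subset_extend hs' hy⟩).symm
        rw [SetLike.mem_coe, LinearMap.mem_ker, Module.Basis.coord_apply, hy', β.repr_self,
          Finsupp.single_eq_of_ne]
        rintro rfl
        exact hk ((hβe _).symm ▸ hsT hy)
      rw [hdot]
      exact hle hx'

/-! ### Regularity of modules of logarithmic vector fields -/

namespace ExteriorModel

variable {n : ℕ} (Λ : ExteriorModel n) {ι : Type*} {a : ι → Fin n → ℂ} {B : Finset ι} {r : ℤ}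

/-- Write `kos z = 0` in the dual bases and contract with all of `l` except its head `k`. Repeated
contractions and those outside `l` vanish, leaving `lin (b k)` times the full contraction up to
sign; torsion-freeness finishes. -/
theorem annList_eq_zero_of_cycle {s : ℕ} {κ : Type*} [Fintype κ] {b v : κ → Fin n → ℂ}
    (hdual : ∀ k, b k ⬝ᵥ v k = 1)
    (hb : ∀ i j, ∑ k, b k i * v k j = if i = j then 1 else 0)
    {z : Λ.idx → Fin s → MvPolynomial (Fin n) ℂ} (hz : Λ.kos z = 0) {l : List κ} (hl : l ≠ [])
    (hz' : ∀ k ∉ l, Λ.ann (v k) z = 0) : Λ.annList (l.map v) z = 0 := by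
  obtain ⟨k, l, rfl⟩ := List.exists_cons_of_ne_nil hl
  refine Λ.eq_zero_of_lin_smul (lin_ne_zero_of_dotProduct (hdual k)) ?_
  have h1 := congrArg (Λ.annList (l.map v)) (Λ.kos_eq_sum_lin hb z)
  rw [hz, annList_zero, annList_sum, Finset.sum_eq_single k] at h1
  · rw [List.map_cons, annList, ann_annList, smul_comm, ← annList_smul, ← h1, smul_zero]
  · intro j _ hjk
    rw [annList_smul]
    by_cases hj : j ∈ l
    · rw [Λ.annList_ann_of_mem _ (List.mem_map_of_mem hj), smul_zero]
    · rw [hz' j fun h => hj ((List.mem_cons.1 h).resolve_left hjk), annList_zero, smul_zero]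
  · simp

/-- Adding a hyperplane transversal to all the others does not change the regularity. -/
theorem koszulRegular_logModule_of_coloop [DecidableEq ι] {j : ι} (hj : j ∈ B) (hr0 : 0 ≤ r)
    {v : Fin n → ℂ} (hjv : a j ⬝ᵥ v = 1) (hv : ∀ i ∈ B.erase j, a i ⬝ᵥ v = 0)
    (h : Λ.KoszulRegular (fun _ => -1) (logModule a (B.erase j)) r) :
    Λ.KoszulRegular (fun _ => -1) (logModule a B) r := by
  intro t ht z hz hz0
  have hl0 := lin_ne_zero_of_dotProduct hjv
  let δ : (Fin n → MvPolynomial (Fin n) ℂ) →ₗ[MvPolynomial (Fin n) ℂ]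
    (Fin 1 → MvPolynomial (Fin n) ℂ) := LinearMap.pi fun _ => linDer (a j)
  let φ : (Fin 1 → MvPolynomial (Fin n) ℂ) →ₗ[MvPolynomial (Fin n) ℂ]
    (Fin n → MvPolynomial (Fin n) ℂ) :=
      LinearMap.pi fun i => (C (v i) : MvPolynomial (Fin n) ℂ) • LinearMap.proj 0
  have hφ : ∀ p, φ p = constField v (p 0) := fun p => by
    ext1 i; simp [φ, constField]
  -- `δ z = lin (a j) • q'`, so `q'` is the component of `z` in the free summand `R a_j ∂_v`. That
  -- summand is generated in degree 0, which is where `0 ≤ r` enters.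
  choose q hq using fun S => (hz S).1 j hj
  let q' : Λ.idx → Fin 1 → MvPolynomial (Fin n) ℂ := fun S _ => q S
  have hq' : lin (a j) • q' = fun S => δ (z S) := by
    ext1 S; ext1 k
    simp [δ, q', hq]
  have hqs : q' ∈ Λ.strand (fun _ => 0) ⊤ t := fun S => ⟨trivial, mem_freePiece.2 fun _ => by
    rw [sub_zero]
    refine mem_polyPiece_of_mul_mem (lin_mem_polyPiece (a j)) hl0 ?_
    rw [add_comm, ← hq]
    exact linDer_mem_polyPiece (hz S).2⟩
  have hq0 : Λ.kos q' = 0 := Λ.eq_zero_of_lin_smul hl0 (by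
    rw [← map_smul, hq', kos_map, hz0]
    ext1 S
    simp)
  obtain ⟨w₁, hw₁, e₁⟩ := Λ.koszulRegular_top (c := fun _ : Fin 1 => 0) (r := r)
    (fun _ => hr0) t ht q' hqs hq0
  let z' : Λ.idx → Fin n → MvPolynomial (Fin n) ℂ := z - fun S => φ ((lin (a j) • q') S)
  have hz'S : ∀ S, z' S = z S - constField v (linDer (a j) (z S)) := fun S => by
    simp only [z', Pi.sub_apply, hφ, hq']
    rfl
  have hproj : ∀ θ, θ ∈ logModule a (B.erase j) →
      θ - constField v (linDer (a j) θ) ∈ logModule a B ∧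
        linDer (a j) (θ - constField v (linDer (a j) θ)) = 0 := fun θ hθ => by
    have h0 : linDer (a j) (θ - constField v (linDer (a j) θ)) = 0 := by
      rw [map_sub, linDer_constField, hjv, C_1, one_mul, sub_self]
    refine ⟨fun i hi => ?_, h0⟩
    by_cases hij : i = j
    · rw [hij, h0]; exact dvd_zero _
    · rw [map_sub, linDer_constField, hv i (Finset.mem_erase.2 ⟨hij, hi⟩), C_0, zero_mul, sub_zero]
      exact hθ i (Finset.mem_erase.2 ⟨hij, hi⟩)
  have hmono := logModule_mono a (B.erase_subset j)
  have hproj' : ∀ (t : ℤ) θ, θ ∈ freePiece (fun _ => -1) t →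
      θ - constField v (linDer (a j) θ) ∈ freePiece (fun _ => -1) t := fun t θ hθ =>
    sub_mem hθ (constField_mem_freePiece (linDer_mem_polyPiece hθ))
  have hkos : Λ.kos z' = 0 := by
    simp only [z']
    rw [map_sub, hz0, zero_sub, neg_eq_zero, kos_map, map_smul, hq0]
    ext1 S
    simp
  obtain ⟨w₂, hw₂, e₂⟩ := h t ht z' (fun S => by
    rw [hz'S]
    exact ⟨hmono (hproj _ (hmono (hz S).1)).1, hproj' _ _ (hz S).2⟩) hkos
  -- `ψ` projects the module of the deletion onto the fields killing `lin (a j)`, all of which are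
  -- logarithmic along `B`.
  let ψ : (Fin n → MvPolynomial (Fin n) ℂ) →ₗ[MvPolynomial (Fin n) ℂ]
    (Fin n → MvPolynomial (Fin n) ℂ) := LinearMap.id - φ.comp δ
  let w₃ : Λ.idx → Fin n → MvPolynomial (Fin n) ℂ := fun S => ψ (w₂ S)
  have hw₃S : ∀ S, w₃ S = w₂ S - constField v (linDer (a j) (w₂ S)) := fun S => by
    simp [w₃, ψ, hφ, δ]
  have e₃ : Λ.kos w₃ = z' := by
    simp only [w₃]
    rw [kos_map, e₂]
    ext1 S
    simp only [ψ, LinearMap.sub_apply, LinearMap.id_apply, LinearMap.comp_apply, hφ, δ,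
      LinearMap.pi_apply]
    rw [hz'S, (hproj _ (hmono (hz S).1)).2]
    ext1 i
    simp [constField]
  refine ⟨w₃ + fun S => φ ((lin (a j) • w₁) S), add_mem (fun S => ?_) (fun S => ⟨fun i hi => ?_, ?_⟩),
    ?_⟩
  · rw [hw₃S]
    exact ⟨(hproj _ (hw₂ S).1).1, hproj' _ _ (hw₂ S).2⟩
  · rw [hφ, linDer_constField]
    by_cases hij : i = j
    · rw [hij]
      exact dvd_mul_of_dvd_right (dvd_mul_right _ _) _
    · rw [hv i (Finset.mem_erase.2 ⟨hij, hi⟩), C_0, zero_mul]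
      exact dvd_zero _
  · rw [hφ]
    refine constField_mem_freePiece (lin_mul_mem_polyPiece _ ?_)
    simpa using mem_freePiece.1 (hw₁ S).2 0
  · rw [map_add, e₃, kos_map, map_smul, e₁]
    simp only [z']
    abel

/-- If no hyperplane is transversal to all the others, deleting any one of the hyperplanes gives a
module which determines the regularity by approximation. -/
theorem koszulRegular_logModule_of_erase [DecidableEq ι] (ha : ∀ i, a i ≠ 0) (hB : B.Nonempty)
    (h : ∀ j ∈ B, Λ.KoszulRegular (fun _ => -1) (logModule a (B.erase j)) (r - 1)) :
    Λ.KoszulRegular (fun _ => -1) (logModule a B) r := by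
  classical
  intro t ht
  obtain ⟨κ, _, b, v, hdual, hdual', hsum, hT⟩ := exists_adapted_dual_bases (a '' (B : Set ι))
  have hT' : ∀ k, b k ∉ a '' (B : Set ι) → ∀ i ∈ B, a i ⬝ᵥ v k = 0 := fun k hk i hi =>
    (hT k).resolve_left hk _ ⟨i, hi, rfl⟩
  set l := (Finset.univ.filter fun k => b k ∈ a '' (B : Set ι)).toList with hl
  have hmem : ∀ k, k ∈ l ↔ b k ∈ a '' (B : Set ι) := fun k => by simp [hl]
  -- Otherwise every `a i` would pair to zero with the whole dual basis, hence be zero.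
  have hl0 : l ≠ [] := by
    intro hnil
    obtain ⟨i, hi⟩ := hB
    refine ha i ?_
    ext1 m
    have h1 : ∀ k, a i ⬝ᵥ v k = 0 := fun k =>
      hT' k (fun hk => by have := (hmem k).2 hk; simp [hnil] at this) i hi
    have h2 : a i m = ∑ k, b k m * (a i ⬝ᵥ v k) := by
      simp only [dotProduct, Finset.mul_sum]
      rw [Finset.sum_comm]
      have : ∀ x, ∑ k, b k m * (a i x * v k x) = a i x * if m = x then 1 else 0 := fun x => by
        rw [← hsum m x, Finset.mul_sum]
        exact Finset.sum_congr rfl fun k _ => by ring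
      simp [this]
    rw [h2]
    simp [h1]
  let j : κ → ι := fun k => if hk : b k ∈ a '' (B : Set ι) then hk.choose else hB.choose
  have hj : ∀ k ∈ l, j k ∈ B ∧ a (j k) = b k := fun k hk => by
    have hk' := (hmem k).1 hk
    simp only [j, dif_pos hk']
    exact hk'.choose_spec
  refine Λ.exists_boundary_of_annList hdual hdual' (r := r - 1)
    (Y := fun k => logModule a (B.erase (j k))) (by linarith) l (Finset.nodup_toList _)
    (fun k hk => h _ (hj k hk).1) (fun k _ => logModule_mono a (B.erase_subset _))
    (fun k hk m hm => ?_) fun z hz hz0 => ?_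
  · rw [← (hj k hk).2]
    exact lin_smul_mem_logModule _ hm
  · have hl₂ : ∀ k ∈ (Finset.univ.filter fun k => b k ∉ a '' (B : Set ι)).toList,
        b k ∉ a '' (B : Set ι) := fun k hk => by
      rw [Finset.mem_toList, Finset.mem_filter] at hk
      exact hk.2
    obtain ⟨z', -, h', w, hw, e⟩ := Λ.exists_homologous_ann_eq_zero hdual hdual'
      (Finset.univ.filter fun k => b k ∉ a '' (B : Set ι)).toList
      (fun k hk m hm => hypProj_mem_logModule (hT' k (hl₂ k hk)) hm)
      (fun k hk m hm => mem_logModule_of_lin_smul_mem ha (hdual k) (hT' k (hl₂ k hk)) hm) hz hz0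
    have hz'0 : Λ.kos z' = 0 := by
      rw [show z' = z - Λ.kos w by rw [e]; abel, map_sub, hz0, kos_kos, sub_zero]
    -- `z'` is already killed by every contraction outside `l`.
    have h0 : Λ.annList (l.map v) z' = 0 :=
      Λ.annList_eq_zero_of_cycle hdual hsum hz'0 hl0 fun k hk => h' k (by
        rw [hmem] at hk
        rw [Finset.mem_toList, Finset.mem_filter]
        exact ⟨Finset.mem_univ _, hk⟩)
    refine ⟨(-1 : ℤ) ^ (l.map v).length • Λ.annList (l.map v) w,
      zsmul_mem (Λ.annList_mem_strand _ hw) _, ?_⟩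
    rw [map_zsmul, kos_annList, smul_smul, ← mul_pow, e, annList_sub, h0]
    simp

/-- The module of logarithmic vector fields of a central arrangement is `(d - ρ)`-regular, where
`d` is the number of hyperplanes and `ρ` is the rank. -/
theorem koszulRegular_logModule (ha : ∀ i, a i ≠ 0) (B : Finset ι) (r : ℤ)
    (hr : (B.card : ℤ) - Module.finrank ℂ (Submodule.span ℂ (a '' (B : Set ι))) ≤ r) :
    Λ.KoszulRegular (fun _ => -1) (logModule a B) r := by
  classical
  induction B using Finset.strongInduction generalizing r with
  | H B ih =>
    have hrank : ∀ A : Finset ι,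
        Module.finrank ℂ (Submodule.span ℂ (a '' (A : Set ι))) ≤ A.card := fun A => by
      rw [← Finset.coe_image]
      exact (finrank_span_finset_le_card _).trans Finset.card_image_le
    have hr0 : 0 ≤ r := by have := hrank B; omega
    rcases B.eq_empty_or_nonempty with rfl | hB
    · have : logModule a ∅ = ⊤ := by
        ext θ; simp [mem_logModule]
      rw [this]
      exact Λ.koszulRegular_top fun _ => by omega
    have hins : ∀ j ∈ B, Submodule.span ℂ (a '' (B : Set ι)) =
        Submodule.span ℂ {a j} ⊔ Submodule.span ℂ (a '' (B.erase j : Finset ι)) := fun j hj => by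
      rw [← Submodule.span_union, Set.singleton_union, ← Set.image_insert_eq, ← Finset.coe_insert,
        Finset.insert_erase hj]
    by_cases hco : ∃ j ∈ B, a j ∉ Submodule.span ℂ (a '' (B.erase j : Finset ι))
    · obtain ⟨j, hj, hja⟩ := hco
      obtain ⟨f, hf, hfs⟩ := Submodule.exists_le_ker_of_notMem hja
      let v : Fin n → ℂ := fun i => (f (a j))⁻¹ * f (Pi.single i 1)
      have hdot : ∀ x, x ⬝ᵥ v = (f (a j))⁻¹ * f x := fun x => by
        conv_rhs => rw [pi_eq_sum_univ' x, map_sum, Finset.mul_sum]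
        refine Finset.sum_congr rfl fun i _ => ?_
        simp only [v, map_smul, smul_eq_mul]
        ring
      refine Λ.koszulRegular_logModule_of_coloop hj hr0 (v := v) ?_ ?_
        (ih _ (Finset.erase_ssubset hj) r ?_)
      · rw [hdot, inv_mul_cancel₀ hf]
      · intro i hi
        rw [hdot, LinearMap.mem_ker.1 (hfs (Submodule.subset_span ⟨i, hi, rfl⟩)), mul_zero]
      -- The rank drops by at most one while the number of forms drops by exactly one, so the same
      -- `r` serves.
      · have h1 : Module.finrank ℂ (Submodule.span ℂ (a '' (B : Set ι))) ≤
            1 + Module.finrank ℂ (Submodule.span ℂ (a '' (B.erase j : Finset ι))) := by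
          rw [hins j hj]
          refine (Submodule.finrank_add_le_finrank_add_finrank _ _).trans ?_
          have := finrank_span_le_card (R := ℂ) ({a j} : Set (Fin n → ℂ))
          simp only [Set.toFinset_singleton, Finset.card_singleton] at this
          omega
        have h2 := Finset.card_erase_add_one hj
        omega
    · push Not at hco
      refine Λ.koszulRegular_logModule_of_erase ha hB fun j hj =>
        ih _ (Finset.erase_ssubset hj) _ ?_
      -- Here the rank is unchanged, so each deletion gains one in regularity.
      have h1 : Submodule.span ℂ (a '' (B : Set ι)) =
          Submodule.span ℂ (a '' (B.erase j : Finset ι)) := by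
        rw [hins j hj, sup_eq_right]
        exact Submodule.span_le.2 (Set.singleton_subset_iff.2 (hco j hj))
      rw [← h1]
      have h2 := Finset.card_erase_add_one hj
      omega

end ExteriorModel

/-! ### Minimal graded free resolutions -/

section Resolutions

variable {n : ℕ}

theorem mem_gradedMaximalIdeal {p : MvPolynomial (Fin n) ℂ} :
    p ∈ gradedMaximalIdeal n ↔ constantCoeff p = 0 := by
  constructor
  · intro hp
    have hle : gradedMaximalIdeal n ≤ RingHom.ker (constantCoeff (R := ℂ) (σ := Fin n)) := by
      refine Ideal.span_le.2 ?_
      rintro _ ⟨i, rfl⟩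
      simp
    exact hle hp
  · intro hp
    rw [gradedMaximalIdeal, ← Set.image_univ, mem_ideal_span_X_image]
    intro m hm
    by_contra! h
    have h0 : m = 0 := by
      ext i
      exact h i (Set.mem_univ i)
    rw [mem_support_iff, h0, ← constantCoeff_eq] at hm
    exact hm hp

theorem constantCoeff_polyComp_zero (p : MvPolynomial (Fin n) ℂ) :
    constantCoeff (polyComp n 0 p) = constantCoeff p := by
  rw [constantCoeff_eq, polyComp, coeff_weightedHomogeneousComponent, if_pos (map_zero _)]

variable {s s' : ℕ} {c : Fin s → ℤ} {c' : Fin s' → ℤ}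

theorem isGradedSubmodule_ker
    {f : (Fin s → MvPolynomial (Fin n) ℂ) →ₗ[MvPolynomial (Fin n) ℂ]
      (Fin s' → MvPolynomial (Fin n) ℂ)}
    (hf : ∀ m, ∀ v ∈ freePiece c m, f v ∈ freePiece c' m) :
    IsGradedSubmodule c (LinearMap.ker f) := fun v hv m => by
  rw [LinearMap.mem_ker, ← freeComp_map f hf, LinearMap.mem_ker.1 hv, map_zero]

/-! ### Regularity of generators and syzygies -/

namespace ExteriorModel

variable (Λ : ExteriorModel n) {r : ℤ}
  {f : (Fin s' → MvPolynomial (Fin n) ℂ) →ₗ[MvPolynomial (Fin n) ℂ]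
    (Fin s → MvPolynomial (Fin n) ℂ)}

/-- The degrees of a minimal set of generators of an `r`-regular module are at most `r`. -/
theorem KoszulRegular.shift_le (h : Λ.KoszulRegular c (LinearMap.range f) r)
    (hf : ∀ m, ∀ v ∈ freePiece c' m, f v ∈ freePiece c m)
    (hmin : ∀ v, f v = 0 → ∀ k, v k ∈ gradedMaximalIdeal n) (k : Fin s') : c' k ≤ r := by
  by_contra! hk
  set e : Fin s' → MvPolynomial (Fin n) ℂ := Pi.single k 1 with he
  have heF : e ∈ freePiece c' (c' k) := mem_freePiece.2 fun l => by
    by_cases hl : l = k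
    · subst hl
      simpa [he] using C_mem_polyPiece (n := n) 1
    · rw [he, Pi.single_eq_of_ne hl]
      exact zero_mem _
  -- A generator placed on the vacuum is a cycle. If it bounds, it lies in `𝔪` times the module,
  -- which contradicts minimality of the cover.
  obtain ⟨w, hw, hwe⟩ := h (c' k) hk (fun S => if S = Λ.vac then f e else 0) (fun S => by
      dsimp only
      split_ifs
      · exact ⟨⟨e, rfl⟩, hf _ _ heF⟩
      · exact ⟨zero_mem _, zero_mem _⟩) (by
      ext1 S
      rw [kos_apply]
      refine Finset.sum_eq_zero fun i _ => ?_
      rw [matAct_apply, Finset.sum_eq_zero, smul_zero]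
      intro T _
      by_cases hT : T = Λ.vac
      · rw [hT, Λ.annih_vac, C_0, zero_smul]
      · rw [if_neg hT, smul_zero])
  choose u hu using fun S => (hw S).1
  have h1 : Λ.kos (fun S => f (u S)) = fun S => f (Λ.kos u S) := Λ.kos_map f u
  have h2 : (fun S => f (u S)) = w := funext hu
  rw [h2, hwe] at h1
  have h3 := congrFun h1 Λ.vac
  simp only [if_true] at h3
  have h4 := hmin (e - Λ.kos u Λ.vac) (by rw [map_sub, h3, sub_self]) k
  rw [mem_gradedMaximalIdeal, Pi.sub_apply, kos_apply, he, Pi.single_eq_same,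
    Finset.sum_apply] at h4
  simp at h4

/-- The first syzygy module of an `r`-regular module is `(r + 1)`-regular. -/
theorem KoszulRegular.ker (h : Λ.KoszulRegular c (LinearMap.range f) r)
    (hf : ∀ m, ∀ v ∈ freePiece c' m, f v ∈ freePiece c m)
    (hmin : ∀ v, f v = 0 → ∀ k, v k ∈ gradedMaximalIdeal n) :
    Λ.KoszulRegular c' (LinearMap.ker f) (r + 1) := by
  intro t ht z hz hz0
  -- By `shift_le` the free cover is itself `r`-regular, so `z` bounds there. The rest corrects `w`
  -- by a boundary so that it lies in the kernel.
  obtain ⟨w, hw, rfl⟩ := Λ.koszulRegular_top (h.shift_le Λ hf hmin) t (by linarith) z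
    (Λ.strand_mono le_top hz) hz0
  have hfz : (fun S => f (Λ.kos w S)) = 0 := funext fun S => (hz S).1
  obtain ⟨u, hu, hue⟩ := h (t - 1) (by linarith) (fun S => f (w S))
    (fun S => ⟨⟨_, rfl⟩, hf _ _ (hw S).2⟩) (by rw [kos_map, hfz])
  choose u₀ hu₀ using fun S => (hu S).1
  -- Passing to components makes the lifts homogeneous without changing their images.
  set u₁ : Λ.idx → Fin s' → MvPolynomial (Fin n) ℂ := fun S => freeComp c' (t - 1 - 1) (u₀ S)
  have hu₁ : (fun S => f (u₁ S)) = u := funext fun S => by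
    rw [← freeComp_map f hf, hu₀, freeComp_of_mem (hu S).2, if_pos rfl]
  have hu₁s : u₁ ∈ Λ.strand c' ⊤ (t - 1 - 1) := fun S => ⟨trivial, freeComp_mem _ _ _⟩
  refine ⟨w - Λ.kos u₁, fun S => ⟨?_, (sub_mem hw (Λ.kos_mem_strand hu₁s) S).2⟩, by
    rw [map_sub, kos_kos, sub_zero]⟩
  have h1 := congrFun (Λ.kos_map f u₁) S
  rw [hu₁, hue] at h1
  rw [LinearMap.mem_ker, Pi.sub_apply, map_sub]
  exact sub_eq_zero.2 h1

end ExteriorModel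

/-! ### Minimal generators -/

theorem IsGradedSubmodule.exists_homogeneous_generators
    {Z : Submodule (MvPolynomial (Fin n) ℂ) (Fin s → MvPolynomial (Fin n) ℂ)}
    (hZ : IsGradedSubmodule c Z) :
    ∃ m, ∃ (d : Fin m → ℤ) (g : Fin m → Fin s → MvPolynomial (Fin n) ℂ),
      (∀ k, g k ∈ freePiece c (d k)) ∧
        Submodule.span (MvPolynomial (Fin n) ℂ) (Set.range g) = Z := by
  obtain ⟨T, hT⟩ := (isNoetherian_def.1 (inferInstance : IsNoetherian (MvPolynomial (Fin n) ℂ)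
    (Fin s → MvPolynomial (Fin n) ℂ))) Z
  choose t ht using fun v : Fin s → MvPolynomial (Fin n) ℂ => exists_sum_freeComp c v
  let κ := Σ v : T, t v
  let g : κ → Fin s → MvPolynomial (Fin n) ℂ := fun x => freeComp c x.2 x.1
  obtain ⟨m, ⟨e⟩⟩ := Finite.exists_equiv_fin κ
  refine ⟨m, fun k => (e.symm k).2, g ∘ e.symm, fun k => freeComp_mem _ _ _, ?_⟩
  rw [e.symm.surjective.range_comp]
  refine le_antisymm ?_ ?_
  · rw [Submodule.span_le]
    rintro _ ⟨x, rfl⟩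
    exact hZ _ (hT ▸ Submodule.subset_span x.1.2) _
  · rw [← hT, Submodule.span_le]
    intro v hv
    rw [SetLike.mem_coe, ht v]
    exact Submodule.sum_mem _ fun m hm => Submodule.subset_span ⟨⟨⟨v, hv⟩, ⟨m, hm⟩⟩, rfl⟩

/-- A graded submodule of a graded free module of finite rank has a minimal graded free cover. -/
theorem IsGradedSubmodule.exists_minimal_cover
    {Z : Submodule (MvPolynomial (Fin n) ℂ) (Fin s → MvPolynomial (Fin n) ℂ)}
    (hZ : IsGradedSubmodule c Z) :
    ∃ (m : ℕ) (d : Fin m → ℤ) (f : (Fin m → MvPolynomial (Fin n) ℂ) →ₗ[MvPolynomial (Fin n) ℂ]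
      (Fin s → MvPolynomial (Fin n) ℂ)), (∀ e, ∀ v ∈ freePiece d e, f v ∈ freePiece c e) ∧
        LinearMap.range f = Z ∧ ∀ v, f v = 0 → ∀ k, v k ∈ gradedMaximalIdeal n := by
  classical
  -- Minimality of the cover comes from using the least possible number of homogeneous generators.
  have hex := hZ.exists_homogeneous_generators
  obtain ⟨d, g, hg, hspan⟩ := Nat.find_spec hex
  have hmin := fun m (h : m < Nat.find hex) => Nat.find_min hex h
  generalize Nat.find hex = m at d g hg hspan hmin
  set f := Fintype.linearCombination (MvPolynomial (Fin n) ℂ) g with hf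
  have hgr : ∀ e, ∀ v ∈ freePiece d e, f v ∈ freePiece c e := fun e v hv => by
    rw [hf, Fintype.linearCombination_apply]
    refine Submodule.sum_mem _ fun k _ => ?_
    have := smul_mem_freePiece (mem_freePiece.1 hv k) (hg k)
    rwa [show d k + (e - d k) = e by ring] at this
  refine ⟨m, d, f, hgr, by rw [hf, Fintype.range_linearCombination, hspan], fun v hv k => ?_⟩
  rw [mem_gradedMaximalIdeal]
  by_contra ha
  obtain ⟨m, rfl⟩ : ∃ m', m = m' + 1 := ⟨m - 1, by have := k.2; omega⟩
  refine hmin m m.lt_succ_self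
    ⟨fun l => d (k.succAbove l), fun l => g (k.succAbove l), fun l => hg _, ?_⟩
  set a := constantCoeff (v k) with hadef
  -- In this component of the relation the coefficient of `g k` has degree 0, hence is the nonzero
  -- constant `a`; so `g k` is redundant.
  set v' := freeComp d (d k) v with hv'
  have hv'0 : f v' = 0 := by rw [hv', ← freeComp_map f hgr, hv, map_zero]
  have hv'k : v' k = C a := by
    have h0 : v' k = polyComp n 0 (v k) := by rw [hv', freeComp_apply, sub_self]
    rw [h0, eq_C_of_mem_polyPiece_zero (polyComp_mem 0 (v k)), constantCoeff_polyComp_zero]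
  rw [hf, Fintype.linearCombination_apply, Fin.sum_univ_succAbove _ k, hv'k] at hv'0
  have hgk : g k = (C (-a⁻¹) : MvPolynomial (Fin n) ℂ) •
      ∑ l, v' (k.succAbove l) • g (k.succAbove l) := by
    rw [← eq_neg_iff_add_eq_zero] at hv'0
    rw [← neg_neg (∑ l, _), ← hv'0, smul_neg, ← neg_smul, smul_smul, ← C_neg, ← C_mul]
    simp [inv_mul_cancel₀ ha]
  rw [← hspan]
  refine le_antisymm (Submodule.span_mono ?_) (Submodule.span_le.2 ?_)
  · rintro _ ⟨l, rfl⟩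
    exact ⟨_, rfl⟩
  · rintro _ ⟨j, rfl⟩
    by_cases hj : j = k
    · rw [SetLike.mem_coe, hj, hgk]
      exact Submodule.smul_mem _ _ (Submodule.sum_mem _ fun l _ =>
        Submodule.smul_mem _ _ (Submodule.subset_span ⟨l, rfl⟩))
    · obtain ⟨l, rfl⟩ := Fin.exists_succAbove_eq hj
      exact Submodule.subset_span ⟨l, rfl⟩

/-- A graded submodule of a graded free module of finite rank. -/
structure GradedSyzygy (n : ℕ) where
  /-- the rank of the ambient free module -/
  rank : ℕ
  /-- the degrees of the basis of the ambient free module -/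
  shift : Fin rank → ℤ
  /-- the submodule -/
  carrier : Submodule (MvPolynomial (Fin n) ℂ) (Fin rank → MvPolynomial (Fin n) ℂ)
  isGraded : IsGradedSubmodule shift carrier

namespace GradedSyzygy

/-- The rank of a minimal free cover. -/
def coverRank (Z : GradedSyzygy n) : ℕ := Z.isGraded.exists_minimal_cover.choose

/-- The degrees of the basis of a minimal free cover. -/
def coverShift (Z : GradedSyzygy n) : Fin Z.coverRank → ℤ :=
  Z.isGraded.exists_minimal_cover.choose_spec.choose

/-- A minimal free cover. -/
def cover (Z : GradedSyzygy n) : (Fin Z.coverRank → MvPolynomial (Fin n) ℂ)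
    →ₗ[MvPolynomial (Fin n) ℂ] (Fin Z.rank → MvPolynomial (Fin n) ℂ) :=
  Z.isGraded.exists_minimal_cover.choose_spec.choose_spec.choose

theorem cover_spec (Z : GradedSyzygy n) :
    (∀ e, ∀ v ∈ freePiece Z.coverShift e, Z.cover v ∈ freePiece Z.shift e) ∧
      LinearMap.range Z.cover = Z.carrier ∧
        ∀ v, Z.cover v = 0 → ∀ k, v k ∈ gradedMaximalIdeal n :=
  Z.isGraded.exists_minimal_cover.choose_spec.choose_spec.choose_spec

/-- The first syzygy module. -/
def next (Z : GradedSyzygy n) : GradedSyzygy n :=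
  ⟨Z.coverRank, Z.coverShift, LinearMap.ker Z.cover, isGradedSubmodule_ker Z.cover_spec.1⟩

/-- The `j`-th syzygy module. -/
def syz (Z : GradedSyzygy n) : ℕ → GradedSyzygy n
  | 0 => Z
  | j + 1 => (Z.syz j).next

end GradedSyzygy

/-! ### Existence of minimal resolutions and bounds on their shifts -/

variable {M : Type*} [AddCommGroup M] [Module ℂ M] [Module (MvPolynomial (Fin n) ℂ) M]
  [IsScalarTower ℂ (MvPolynomial (Fin n) ℂ) M] {𝓜 : ℤ → Submodule ℂ M}

/-- A module isomorphic to a graded submodule of a graded free module of finite rank has a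
minimal graded free resolution. -/
theorem nonempty_minimalGradedFreeResolution
    (e : M →ₗ[MvPolynomial (Fin n) ℂ] (Fin s → MvPolynomial (Fin n) ℂ))
    (he : Function.Injective e) (hM : ∀ m x, x ∈ 𝓜 m ↔ e x ∈ freePiece c m)
    (hgr : IsGradedSubmodule c (LinearMap.range e)) :
    Nonempty (MinimalGradedFreeResolution (n := n) 𝓜) := by
  let Z : GradedSyzygy n := ⟨s, c, LinearMap.range e, hgr⟩
  have hmem : ∀ v, Z.cover v ∈ LinearMap.range e := fun v => by
    have h := LinearMap.mem_range_self Z.cover v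
    rw [Z.cover_spec.2.1] at h
    exact h
  let aug : (Fin Z.coverRank → MvPolynomial (Fin n) ℂ) →ₗ[MvPolynomial (Fin n) ℂ] M :=
    (LinearEquiv.ofInjective e he).symm.toLinearMap.comp (Z.cover.codRestrict _ hmem)
  have haug : ∀ v, e (aug v) = Z.cover v := fun v =>
    congrArg Subtype.val ((LinearEquiv.ofInjective e he).apply_symm_apply ⟨Z.cover v, hmem v⟩)
  have haug_graded : ∀ m, ∀ v ∈ freePiece Z.coverShift m, aug v ∈ 𝓜 m := fun m v hv => by
    rw [hM, haug]
    exact Z.cover_spec.1 m v hv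
  have haug_surjective : Function.Surjective aug := fun x => by
    have hx : e x ∈ LinearMap.range Z.cover :=
      Z.cover_spec.2.1.symm ▸ LinearMap.mem_range_self e x
    obtain ⟨v, hv⟩ := hx
    exact ⟨v, he (by rw [haug, hv])⟩
  have haug_eq_zero : ∀ v, aug v = 0 ↔ Z.cover v = 0 := fun v => by
    rw [← map_eq_zero_iff e he, haug]
  exact ⟨{
    -- `F_j` is the free module containing the `(j + 1)`-st syzygy module, hence the index shift.
    rank := fun j => (Z.syz (j + 1)).rank
    shift := fun j => (Z.syz (j + 1)).shift
    diff := fun j => (Z.syz (j + 1)).cover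
    aug := aug
    diff_graded := fun j => (Z.syz (j + 1)).cover_spec.1
    aug_graded := haug_graded
    aug_surjective := haug_surjective
    exact_aug := fun v => by
      have h : v ∈ LinearMap.range (Z.syz 1).cover ↔ v ∈ LinearMap.ker Z.cover := by
        rw [(Z.syz 1).cover_spec.2.1]; rfl
      exact (haug_eq_zero v).trans h.symm
    exact_diff := fun j v => by
      have h : v ∈ LinearMap.range (Z.syz (j + 1 + 1)).cover ↔
          v ∈ LinearMap.ker (Z.syz (j + 1)).cover := by
        rw [(Z.syz (j + 1 + 1)).cover_spec.2.1]; rfl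
      exact h.symm
    minimal := fun j v k => by
      have h : (Z.syz (j + 1)).cover v ∈ LinearMap.ker (Z.syz j).cover := by
        have h1 := (Z.syz (j + 1)).cover_spec.2.1 ▸
          LinearMap.mem_range_self (Z.syz (j + 1)).cover v
        exact h1
      exact (Z.syz j).cover_spec.2.2 _ h k }⟩

/-- The shifts in a minimal graded free resolution are bounded by the regularity. -/
theorem MinimalGradedFreeResolution.shift_le (F : MinimalGradedFreeResolution (n := n) 𝓜)
    (Λ : ExteriorModel n)
    (e : M →ₗ[MvPolynomial (Fin n) ℂ] (Fin s → MvPolynomial (Fin n) ℂ))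
    (he : Function.Injective e) (hM : ∀ m x, x ∈ 𝓜 m ↔ e x ∈ freePiece c m) {r : ℤ}
    (hr : Λ.KoszulRegular c (LinearMap.range e) r) (j : ℕ) (k : Fin (F.rank j)) :
    F.shift j k ≤ r + j := by
  have hrange : LinearMap.range (e.comp F.aug) = LinearMap.range e :=
    LinearMap.range_comp_of_range_eq_top _ (LinearMap.range_eq_top.2 F.aug_surjective)
  have hgr : ∀ m, ∀ v ∈ freePiece (F.shift 0) m, e.comp F.aug v ∈ freePiece c m :=
    fun m v hv => (hM m _).1 (F.aug_graded m v hv)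
  have hker : LinearMap.ker (e.comp F.aug) = LinearMap.range (F.diff 0) := by
    rw [LinearMap.ker_comp_of_ker_eq_bot _ (LinearMap.ker_eq_bot.2 he)]
    exact F.exact_aug.linearMap_ker_eq
  have hmin : ∀ v, e.comp F.aug v = 0 → ∀ k, v k ∈ gradedMaximalIdeal n := fun v hv k => by
    have hv' : v ∈ LinearMap.range (F.diff 0) := hker ▸ hv
    obtain ⟨u, rfl⟩ := hv'
    exact F.minimal 0 u k
  have hmin' : ∀ j v, F.diff j v = 0 → ∀ k, v k ∈ gradedMaximalIdeal n := fun j v hv k => by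
    obtain ⟨u, rfl⟩ := (F.exact_diff j v).1 hv
    exact F.minimal (j + 1) u k
  rw [← hrange] at hr
  -- The image of `F_{j+1}` in `F_j` is the `(j + 1)`-st syzygy module, which accounts for `j + 1`.
  have hreg : ∀ j : ℕ, Λ.KoszulRegular (F.shift j) (LinearMap.range (F.diff j)) (r + j + 1) := by
    intro j
    induction j with
    | zero =>
      rw [← hker]
      simpa using hr.ker Λ hgr hmin
    | succ j ih =>
      have h := ih.ker Λ (F.diff_graded j) (hmin' j)
      rw [(F.exact_diff j).linearMap_ker_eq] at h
      convert h using 1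
      push_cast
      ring
  rcases j with _ | j
  · simpa using hr.shift_le Λ hgr hmin k
  · have := (hreg j).shift_le Λ (F.diff_graded j) (hmin' j) k
    push_cast
    linarith

end Resolutions

/-! ### Logarithmic vector fields of an arrangement -/

section LogDer

variable {n : ℕ}

theorem exists_eq_lin_of_isHomogeneous {p : MvPolynomial (Fin n) ℂ} (hp : p.IsHomogeneous 1) :
    ∃ a : Fin n → ℂ, p = lin a := by
  have h : p ∈ Submodule.span ℂ (Set.range (X : Fin n → MvPolynomial (Fin n) ℂ)) := by
    rw [← homogeneousSubmodule_one_eq_span_X]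
    exact hp
  obtain ⟨a, rfl⟩ := (Submodule.mem_span_range_iff_exists_fun ℂ).1 h
  exact ⟨a, by simp only [lin, smul_eq_C_mul]⟩

/-- The coefficients of a vector field. -/
def fieldCoeff (n : ℕ) :
    Derivation ℂ (MvPolynomial (Fin n) ℂ) (MvPolynomial (Fin n) ℂ) →ₗ[MvPolynomial (Fin n) ℂ]
      (Fin n → MvPolynomial (Fin n) ℂ) where
  toFun θ i := θ (X i)
  map_add' _ _ := rfl
  map_smul' _ _ := rfl

theorem fieldCoeff_injective : Function.Injective (fieldCoeff n) := fun _ _ h =>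
  derivation_ext fun i => congrFun h i

theorem derivation_lin (θ : Derivation ℂ (MvPolynomial (Fin n) ℂ) (MvPolynomial (Fin n) ℂ))
    (a : Fin n → ℂ) : θ (lin a) = linDer a (fieldCoeff n θ) := by
  rw [linDer_apply, lin, map_sum]
  refine Finset.sum_congr rfl fun i _ => ?_
  rw [← smul_eq_C_mul, ← smul_eq_C_mul, Derivation.map_smul]
  rfl

theorem mem_logDer_iff {f : MvPolynomial (Fin n) ℂ}
    {θ : Derivation ℂ (MvPolynomial (Fin n) ℂ) (MvPolynomial (Fin n) ℂ)} :
    θ ∈ logDer f ↔ f ∣ θ f := Ideal.mem_span_singleton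

theorem prod_dvd_derivation_prod {ι : Type*} (T : Finset ι) (g : ι → MvPolynomial (Fin n) ℂ)
    (θ : Derivation ℂ (MvPolynomial (Fin n) ℂ) (MvPolynomial (Fin n) ℂ))
    (h : ∀ i ∈ T, g i ∣ θ (g i)) : ∏ i ∈ T, g i ∣ θ (∏ i ∈ T, g i) := by
  classical
  induction T using Finset.induction_on with
  | empty => simp
  | insert i T hi ih =>
    rw [Finset.prod_insert hi, Derivation.leibniz, smul_eq_mul, smul_eq_mul]
    refine dvd_add (mul_dvd_mul_left _ (ih fun j hj => h j (Finset.mem_insert_of_mem hj))) ?_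
    rw [mul_comm]
    exact mul_dvd_mul_left _ (h i (Finset.mem_insert_self _ _))

/-- A vector field is logarithmic along a reduced arrangement if and only if it is logarithmic
along each hyperplane. -/
theorem mem_logDer_prod_lin_iff {ι : Type*} [Fintype ι] {a : ι → Fin n → ℂ} (ha : ∀ i, a i ≠ 0)
    (hsq : Squarefree (∏ i, lin (a i)))
    (θ : Derivation ℂ (MvPolynomial (Fin n) ℂ) (MvPolynomial (Fin n) ℂ)) :
    θ ∈ logDer (∏ i, lin (a i)) ↔ fieldCoeff n θ ∈ logModule a Finset.univ := by
  classical
  rw [mem_logDer_iff, mem_logModule]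
  simp only [← derivation_lin]
  refine ⟨fun h i hi => ?_, fun h => prod_dvd_derivation_prod _ _ θ h⟩
  have hp := prime_lin (ha i)
  -- Modulo `lin (a i)`, the Leibniz rule leaves only the cofactor times `θ (lin (a i))`;
  -- squarefreeness says that this prime does not divide the cofactor.
  rw [← Finset.mul_prod_erase _ _ hi] at h hsq
  have h1 := (dvd_mul_right _ _).trans h
  rw [Derivation.leibniz, smul_eq_mul, smul_eq_mul] at h1
  have h2 := (dvd_add_right (dvd_mul_right _ _)).1 h1
  exact (hp.2.2 _ _ h2).resolve_left fun h3 =>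
    hp.not_isUnit (hsq _ (mul_dvd_mul_left _ h3))

theorem range_fieldCoeff_logDer {ι : Type*} [Fintype ι] {a : ι → Fin n → ℂ} (ha : ∀ i, a i ≠ 0)
    (hsq : Squarefree (∏ i, lin (a i))) :
    LinearMap.range ((fieldCoeff n).comp (logDer (∏ i, lin (a i))).subtype) =
      logModule a Finset.univ := by
  ext v
  constructor
  · rintro ⟨θ, rfl⟩
    exact (mem_logDer_prod_lin_iff ha hsq _).1 θ.2
  · intro hv
    have h : fieldCoeff n (mkDerivation ℂ v) = v := funext fun i => mkDerivation_X _ _ _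
    exact ⟨⟨mkDerivation ℂ v, (mem_logDer_prod_lin_iff ha hsq _).2 (h.symm ▸ hv)⟩, h⟩

theorem isGradedSubmodule_logModule {ι : Type*} (a : ι → Fin n → ℂ) (B : Finset ι) :
    IsGradedSubmodule (fun _ => -1) (logModule a B) := fun θ hθ m i hi => by
  obtain ⟨q, hq⟩ := hθ i hi
  refine ⟨polyComp n m q, ?_⟩
  rw [← polyComp_mul (lin_mem_polyPiece _), ← hq, linDer_apply, linDer_apply, map_sum]
  refine Finset.sum_congr rfl fun k _ => ?_
  rw [freeComp_apply, ← smul_eq_C_mul, ← smul_eq_C_mul, map_smul, sub_neg_eq_add, add_comm]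

namespace CentralArrangement

variable (D : CentralArrangement n)

theorem degree_eq_size : D.degree = D.size := by
  have h := IsHomogeneous.prod Finset.univ D.form (fun _ => 1) fun i _ => D.form_isHomogeneous i
  have h1 := h.totalDegree (Finset.prod_ne_zero_iff.2 fun i _ => D.form_ne_zero i)
  simpa [degree, definingPoly] using h1

/-- A nonzero functional vanishing on all coefficient vectors is a nonzero point common to all the
hyperplanes. -/
theorem span_eq_top_of_isEssential (hess : D.IsEssential) {a : Fin D.size → Fin n → ℂ}
    (ha : ∀ i, D.form i = lin (a i)) : Submodule.span ℂ (Set.range a) = ⊤ := by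
  by_contra h
  obtain ⟨f, hf, hle⟩ := Submodule.exists_le_ker_of_lt_top _ (lt_top_iff_ne_top.2 h)
  have hdot : ∀ x, x ⬝ᵥ (fun i => f (Pi.single i 1)) = f x := fun x => by
    conv_rhs => rw [pi_eq_sum_univ' x, map_sum]
    refine Finset.sum_congr rfl fun i _ => ?_
    rw [map_smul, smul_eq_mul]
  have h0 := hess (fun i => f (Pi.single i 1)) fun i => by
    rw [ha, eval_lin, hdot]
    exact hle (Submodule.subset_span ⟨i, rfl⟩)
  refine hf (LinearMap.ext fun x => ?_)
  rw [← hdot, h0, dotProduct_zero, LinearMap.zero_apply]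

end CentralArrangement

end LogDer

end

theorem proposition1p3 (n : ℕ) (D : CentralArrangement n)
    (hred : D.IsReduced) (hess : D.IsEssential) :
    Nonempty (MinimalGradedFreeResolution (n := n) (M := logDer D.definingPoly)
        (logDerPiece D.definingPoly)) ∧
      cmRegularity n (M := logDer D.definingPoly) (logDerPiece D.definingPoly) ≤
        ((((D.degree : ℤ) - (n : ℤ) : ℤ) : ℝ) : EReal) := by
  choose a ha using fun i => exists_eq_lin_of_isHomogeneous (D.form_isHomogeneous i)
  have hf : D.definingPoly = ∏ i, lin (a i) := Finset.prod_congr rfl fun i _ => ha i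
  have ha0 : ∀ i, a i ≠ 0 := fun i h => D.form_ne_zero i (by rw [ha, h]; simp [lin])
  have hrange : LinearMap.range ((fieldCoeff n).comp (logDer D.definingPoly).subtype) =
      logModule a Finset.univ := by
    rw [hf]
    exact range_fieldCoeff_logDer ha0 (hf ▸ hred)
  have hinj : Function.Injective ((fieldCoeff n).comp (logDer D.definingPoly).subtype) :=
    fieldCoeff_injective.comp Subtype.val_injective
  have hM : ∀ (m : ℤ) (θ : logDer D.definingPoly), θ ∈ logDerPiece D.definingPoly m ↔
      (fieldCoeff n).comp (logDer D.definingPoly).subtype θ ∈ freePiece (fun _ => -1) m := by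
    intro m θ
    rw [mem_freePiece]
    simp only [sub_neg_eq_add]
    rfl
  refine ⟨nonempty_minimalGradedFreeResolution _ hinj hM
    (hrange ▸ isGradedSubmodule_logModule a _), ?_⟩
  have hreg : (ExteriorModel.build n).KoszulRegular (fun _ => -1)
      (LinearMap.range ((fieldCoeff n).comp (logDer D.definingPoly).subtype))
        ((D.degree : ℤ) - n) := by
    rw [hrange]
    refine ExteriorModel.koszulRegular_logModule _ ha0 _ _ (le_of_eq ?_)
    rw [Finset.coe_univ, Set.image_univ, D.span_eq_top_of_isEssential hess ha, finrank_top,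
      D.degree_eq_size]
    simp
  -- `cmRegularity` is a supremum over all minimal resolutions, so an arbitrary one must be bounded,
  -- not just the one constructed.
  refine iSup_le fun F => iSup_le fun j => iSup_le fun k => ?_
  have h := F.shift_le _ _ hinj hM hreg j k
  rw [EReal.coe_le_coe_iff]
  exact_mod_cast sub_le_iff_le_add.2 h
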